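/- **Setting.** Let $1\le K\le k\le d$, $\omega,\sigma>0$, $\gamma\ge 0$. Let $A\in\mathbb R^{n\times d}$ be a random matrix with rows $a_1,\dots,a_n$ whose entries are i.i.d., centered and $\sigma$-sub-Gaussian ($\mathbb E e^{z a_{ij}}\le e^{\sigma^2z^2/2}$ for all $z\in\mathbb R$). Let $x^*\in\mathbb R^d$ satisfy $\|x^*\|_0\le K$, $\|x^*\|_2\le\omega$, and let the labels $y_i\in\{1,-1\}$ satisfy $\mathbb P(y_i=v\mid a_i)=\frac{\exp(2v\,a_i^\top x^*)}{1+\exp(2v\,a_i^\top x^*)}$ for $v=\pm1$, the pairs $(a_i,y_i)$ being independent. Put $$f_i(x)=\log\bigl(1+\exp(-2y_ia_i^\top x)\bigr)+\tfrac{\gamma}{2}\|x\|_2^2,\qquad F(x)=\frac1n\sum_{i=1}^nf_i(x),$$ and let $\hat x$ be any global minimizer of $F$ over $\{x:\|x\|_0\le q,\ \|x\|_2\le\omega\}$, where $q=K$ or $q=k$. (RSC) with parameter $\alpha>0$ means $F(x')-F(x)-\langle\nabla F(x),x'-x\rangle\ge\frac\alpha2\|x'-x\|_2^2$ whenever $\|x-x'\|_0\le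 k+K$. (RSS) with parameter $L$ means, for every $i$, $\|\nabla f_i(x')-\nabla f_i(x)\|_2\le L\|x'-x\|_2$ whenever $\|x-x'\|_0\le 3k+K$. **Algorithm (HT-SVRG)** with step size $\eta$, update frequency $m$ and start $\tilde x^0$ ($\|\tilde x^0\|_0\le k$, $\|\tilde x^0\|_2\le\omega$). At stage $s\ge1$ put $\tilde x=\tilde x^{s-1}$, $x^0=\tilde x$, and for $t=1,\dots,m$ draw $i_t$ uniformly from $\{1,\dots,n\}$ and set $$x^t=\Pi_\omega\Bigl(\mathcal H_k\bigl(x^{t-1}-\eta(\nabla f_{i_t}(x^{t-1})-\nabla f_{i_t}(\tilde x)+\nabla F(\tilde x))\bigr)\Bigr),$$ where $\mathcal H_k$ keeps $k$ entries of largest absolute value (ties broken arbitrarily) and sets the others to $0$, and $\Pi_\omega(v)=v/\max\{1,\|v\|_2/\omega\}$. Then draw $j$ uniformly from $\{0,\dots,m-1\}$ and set $\tilde x^s=x^j$. All draws are independent. Let $$\nu=1+\frac{\rho+\sqrt{(4+\rho)\rho}}2,\qquad \rho=\frac{\min\{K,d-k\}}{k-K+\min\{K,d-k\}}\quad(\rho=0\text{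 if }k=K=d).$$ **Proposition 10.** There are absolute constants $C_0>0$, $\eta_0\in(0,1/4)$, $M>0$ and $\beta\in(0,1)$ such that for all $\omega>0$ and $C_1>0$ there is a constant $C>0$, depending only on $\omega$ and $C_1$, with the following property. Suppose $$n\ge C_0(3k+K)\log d,\qquad 0\le\gamma\le C_1\sqrt{\frac{(3k+K)\log d}{n}}.$$ Then there is an event of probability at least $1-4/d$, in terms of $(A,y)$, on which the following holds: if $F$ satisfies RSC with parameter $\alpha$ and the $f_i$ satisfy RSS with parameter $L$, if $0<\eta\le\eta_0/L$, $\nu\le 1/(1-\eta\alpha)$ and $m\ge M/(\eta\alpha)$, then HT-SVRG converges linearly up to an optimization error $\tau$: there is $\tau$ with $$0\le\tau\le C\,\sigma\sqrt{\frac{(3k+K)\log d}{n}}$$ such that, for all $s\ge0$, $$\mathbb E\bigl[F(\tilde x^s)-F(\hat x)\bigr]\le\beta^s\bigl[F(\tilde x^0)-F(\hat x)\bigr]+\tau,$$ where the expectation is over the draws of the algorithm only, and $\log$ is the natural logarithm. -/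

import Mathlib

open MeasureTheory ProbabilityTheory
open scoped BigOperators

noncomputable section

namespace HTSVRG

/-- The space `ℝ^d` with its Euclidean norm. -/
abbrev E (d : ℕ) : Type := EuclideanSpace ℝ (Fin d)

/-- The number of nonzero coordinates of `x`. -/
def zeroNorm {d : ℕ} (x : E d) : ℕ := hammingNorm (fun i => x i)

/-- The coordinate projection onto `Γ`: coordinates in `Γ` are kept, the others are set to zero. -/
def coordProj {d : ℕ} (Γ : Finset (Fin d)) (b : E d) : E d :=
  WithLp.toLp 2 (fun i => if i ∈ Γ then b i else 0)

/-- `H` is a hard thresholding operator of level `k`: it keeps `k` entries of largest absolute value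
and sets the others to zero. Ties may be broken in any way. -/
def IsHardThresholding {d : ℕ} (k : ℕ) (H : E d → E d) : Prop :=
  ∀ b : E d, ∃ Γ : Finset (Fin d), Γ.card = min k d ∧
    (∀ i ∈ Γ, ∀ j ∉ Γ, |b j| ≤ |b i|) ∧ H b = coordProj Γ b

/-- The projection onto the Euclidean ball of radius `ω`. -/
def ballProj {d : ℕ} (ω : ℝ) (v : E d) : E d := (max 1 (‖v‖ / ω))⁻¹ • v

/-- The ratio `ρ` of the expansiveness factor of hard thresholding. -/
def rhoFactor (d k K : ℕ) : ℝ :=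
  min (K : ℝ) ((d : ℝ) - k) / ((k : ℝ) - K + min (K : ℝ) ((d : ℝ) - k))

/-- The expansiveness factor `ν` of hard thresholding at level `k` relative to `K`-sparse points. -/
def nuFactor (d k K : ℕ) : ℝ :=
  1 + (rhoFactor d k K + √((4 + rhoFactor d k K) * rhoFactor d k K)) / 2

/-- Restricted strong convexity at sparsity level `r` with parameter `α > 0`. -/
def RSC {d : ℕ} (r : ℕ) (α : ℝ) (f : E d → ℝ) : Prop :=
  0 < α ∧ Differentiable ℝ f ∧ ∀ x x' : E d, zeroNorm (x - x') ≤ r →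
    α / 2 * ‖x' - x‖ ^ 2 ≤ f x' - f x - inner ℝ (gradient f x) (x' - x)

/-- Restricted smoothness at sparsity level `r` with parameter `L`. -/
def RSS {d : ℕ} (r : ℕ) (L : ℝ) (f : E d → ℝ) : Prop :=
  Differentiable ℝ f ∧ ∀ x x' : E d, zeroNorm (x - x') ≤ r →
    ‖gradient f x' - gradient f x‖ ≤ L * ‖x' - x‖

/-- The empirical average of the component functions `f i`. -/
def average {n d : ℕ} (f : Fin n → E d → ℝ) (x : E d) : ℝ := (n : ℝ)⁻¹ * ∑ i, f i x

/-- `xh` is a global minimizer of `F` over the `q`-sparse points of the ball of radius `ω`. -/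
def IsSparseOptimum {d : ℕ} (q : ℕ) (ω : ℝ) (F : E d → ℝ) (xh : E d) : Prop :=
  zeroNorm xh ≤ q ∧ ‖xh‖ ≤ ω ∧ ∀ x : E d, zeroNorm x ≤ q → ‖x‖ ≤ ω → F xh ≤ F x

/-- The `ℓ₂`-regularized logistic loss of one sample `(a, v)`. -/
def logisticLoss {d : ℕ} (γ : ℝ) (a : E d) (v : ℝ) (x : E d) : ℝ :=
  Real.log (1 + Real.exp (-2 * v * inner ℝ a x)) + γ / 2 * ‖x‖ ^ 2

/-- One inner update of HT-SVRG with snapshot `xt`, current point `x` and sample index `i`. -/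
def innerStep {n d : ℕ} (f : Fin n → E d → ℝ) (H : E d → E d) (ω η : ℝ) (xt x : E d) (i : Fin n) :
    E d :=
  ballProj ω (H (x - η •
    (gradient (f i) x - gradient (f i) xt + (n : ℝ)⁻¹ • ∑ l, gradient (f l) xt)))

/-- The inner iterates `x^0, x^1, …, x^m` of one stage with snapshot `xt`, for the sequence `I` of
drawn sample indices. -/
def innerIterate {n d m : ℕ} (f : Fin n → E d → ℝ) (H : E d → E d) (ω η : ℝ) (xt : E d)
    (I : Fin m → Fin n) : ℕ → E d
  | 0 => xt
  | t + 1 =>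
    if h : t < m then innerStep f H ω η xt (innerIterate f H ω η xt I t) (I ⟨t, h⟩)
    else innerIterate f H ω η xt I t

/-- The random draws of one stage: the indices `i_1, …, i_m` and the index `j` in `{0, …, m - 1}` of
the inner iterate that is returned. -/
abbrev Draws (n m : ℕ) : Type := (Fin m → Fin n) × Fin m

/-- The output of HT-SVRG after `s` stages started at `x0`, as a function of the draws of the `s`
stages. -/
def iterate {n d m : ℕ} (f : Fin n → E d → ℝ) (H : E d → E d) (ω η : ℝ) (x0 : E d) :
    (s : ℕ) → (Fin s → Draws n m) → E d
  | 0, _ => x0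
  | s + 1, D =>
    innerIterate f H ω η (iterate f H ω η x0 s fun r => D r.castSucc)
      (D (Fin.last s)).1 (D (Fin.last s)).2

/-- The expected value of `F` at the output of HT-SVRG after `s` stages. All draws are independent and
uniform, so this is the uniform average over all outcomes of the draws. -/
def expectedValue {n d : ℕ} (f : Fin n → E d → ℝ) (H : E d → E d) (ω η : ℝ) (m : ℕ) (x0 : E d)
    (s : ℕ) (F : E d → ℝ) : ℝ :=
  Finset.expect Finset.univ fun D : Fin s → Draws n m => F (iterate f H ω η x0 s D)

/-- The logistic regression model with true parameter `xs` and i.i.d. centered `σ`-sub-Gaussian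
design: the rows of the design are the `A i`, the labels are the `y i`, the samples `(A i, y i)` are
independent, and, given `A i`, the label `v ∈ {1, -1}` has probability
`exp (2 v ⟨A i, xs⟩) / (1 + exp (2 v ⟨A i, xs⟩))`. -/
structure IsLogisticModel {n d : ℕ} {Ω : Type*} [MeasurableSpace Ω] (μ : Measure Ω) (σ : ℝ)
    (xs : E d) (A : Fin n → Ω → E d) (y : Fin n → Ω → ℝ) : Prop where
  measurable_design : ∀ i, Measurable (A i)
  measurable_label : ∀ i, Measurable (y i)
  indep_entries : iIndepFun (fun (p : Fin n × Fin d) (w : Ω) => A p.1 w p.2) μ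
  identDistrib_entries : ∀ p q : Fin n × Fin d,
    IdentDistrib (fun w => A p.1 w p.2) (fun w => A q.1 w q.2) μ μ
  mean_zero : ∀ i j, ∫ w, A i w j ∂μ = 0
  subGaussian : ∀ i j, HasSubgaussianMGF (fun w => A i w j) (Real.toNNReal (σ ^ 2)) μ
  label_values : ∀ i w, y i w = 1 ∨ y i w = -1
  indep_samples : iIndepFun (fun (i : Fin n) (w : Ω) => (A i w, y i w)) μ
  label_law : ∀ i, ∀ v : ℝ, v = 1 ∨ v = -1 →
    μ[Set.indicator {w | y i w = v} (fun _ => (1 : ℝ)) |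
        MeasurableSpace.comap (A i) inferInstance] =ᵐ[μ]
      fun w => Real.exp (2 * v * inner ℝ (A i w) xs) /
        (1 + Real.exp (2 * v * inner ℝ (A i w) xs))

/-- The rate `√((3k + K) log d / n)`. -/
def rate (n d k K : ℕ) : ℝ := √((3 * (k : ℝ) + K) * Real.log d / n)

end HTSVRG

end

/-! The proof separates a deterministic contraction argument from a probabilistic gradient bound;
they meet at a reference point `z` which is `K`-sparse, lies in the ball and depends only on the
model.

Deterministically, the squared distance of the inner iterates to `z` is tracked. Projection onto the
ball does not increase it, and hard thresholding expands it by at most `ν`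
(`norm_coordProj_sub_sq_le`), which needs `z` to be `K`-sparse; so `x̂` is not a suitable centre
when `q = k`. Restricted cocoercivity bounds the variance of the step by Bregman divergences to `z`,
and strong convexity gives a factor `1 - ηα` that absorbs `ν`. Telescoping over a stage halves the
expected Bregman divergence up to a multiple of `ωG`, where `G` bounds the gradient of `F` at `z` on
sparse coordinate sets (`expect_bregman_le`). On feasible points, `F - F z` and the Bregman
divergence differ by at most `2ωG`, and `F x̂` is within `2ωG` of `F z`, so the contraction carries
over to `F - F x̂` (`expectedValue_sub_le`).

Probabilistically, the gradient at `x*` has the bias `γ x*`, which does not scale with `σ`. Hence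
`z` is taken to minimize the regularized population risk over vectors supported in the support of
`x*` (`exists_reference_point`). On that support the population gradient vanishes by stationarity;
off it, because a design coordinate there is centered and independent of everything the mean score
sees. The empirical gradient at `z` is thus a centered sum, each coordinate of which is sub-Gaussian
since the logistic derivative is bounded by 2. A union bound over the coordinates gives `G = 8σ ·
rate` (`exists_score_event`). -/

noncomputable section

/-! ### Sparse vectors and the expansiveness of hard thresholding. -/

namespace HTSVRG

/-! ### Sparse vectors and coordinate projections -/

/-- The set of nonzero coordinates of `x`. -/
def supp {d : ℕ} (x : E d) : Finset (Fin d) := Finset.univ.filter fun j => x j ≠ 0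

lemma card_supp {d : ℕ} (x : E d) : (supp x).card = zeroNorm x := rfl

lemma eq_zero_of_notMem_supp {d : ℕ} {x : E d} {j : Fin d} (h : j ∉ supp x) : x j = 0 := by
  simpa [supp] using h

lemma supp_subset_iff {d : ℕ} {x : E d} {I : Finset (Fin d)} :
    supp x ⊆ I ↔ ∀ j, j ∉ I → x j = 0 := by
  constructor
  · intro h j hj
    exact eq_zero_of_notMem_supp fun hx => hj (h hx)
  · intro h j hj
    by_contra hI
    simp [supp] at hj
    exact hj (h j hI)

lemma zeroNorm_le_card {d : ℕ} {x : E d} {I : Finset (Fin d)} (h : supp x ⊆ I) :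
    zeroNorm x ≤ I.card :=
  card_supp x ▸ Finset.card_le_card h

lemma supp_sub_subset {d : ℕ} {x y : E d} {I : Finset (Fin d)} (hx : supp x ⊆ I)
    (hy : supp y ⊆ I) : supp (x - y) ⊆ I := by
  rw [supp_subset_iff] at *
  intro j hj
  simp [hx j hj, hy j hj]

lemma supp_smul_subset {d : ℕ} (c : ℝ) {x : E d} {I : Finset (Fin d)} (hx : supp x ⊆ I) :
    supp (c • x) ⊆ I := by
  rw [supp_subset_iff] at *
  intro j hj
  simp [hx j hj]

lemma zeroNorm_sub_le {d : ℕ} (x y : E d) : zeroNorm (x - y) ≤ zeroNorm x + zeroNorm y :=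
  (zeroNorm_le_card (supp_sub_subset (I := supp x ∪ supp y) Finset.subset_union_left
    Finset.subset_union_right)).trans (Finset.card_union_le _ _)

lemma norm_sq_eq_sum {d : ℕ} (x : E d) : ‖x‖ ^ 2 = ∑ j, x j ^ 2 :=
  EuclideanSpace.real_norm_sq_eq x

lemma inner_eq_sum {d : ℕ} (x y : E d) : inner ℝ x y = ∑ j, x j * y j := by
  rw [PiLp.inner_apply]
  exact Finset.sum_congr rfl fun j _ => by simp [mul_comm]

@[simp] lemma coordProj_apply {d : ℕ} (I : Finset (Fin d)) (b : E d) (j : Fin d) :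
    coordProj I b j = if j ∈ I then b j else 0 := rfl

lemma coordProj_add {d : ℕ} (I : Finset (Fin d)) (a b : E d) :
    coordProj I (a + b) = coordProj I a + coordProj I b := by
  ext j; by_cases h : j ∈ I <;> simp [h]

lemma coordProj_sub {d : ℕ} (I : Finset (Fin d)) (a b : E d) :
    coordProj I (a - b) = coordProj I a - coordProj I b := by
  ext j; by_cases h : j ∈ I <;> simp [h]

lemma coordProj_smul {d : ℕ} (I : Finset (Fin d)) (c : ℝ) (b : E d) :
    coordProj I (c • b) = c • coordProj I b := by
  ext j; by_cases h : j ∈ I <;> simp [h]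

lemma coordProj_of_supp_subset {d : ℕ} {I : Finset (Fin d)} {x : E d} (h : supp x ⊆ I) :
    coordProj I x = x := by
  rw [supp_subset_iff] at h
  ext j; by_cases hj : j ∈ I <;> simp [hj, h]

lemma coordProj_coordProj_of_subset {d : ℕ} {Γ I : Finset (Fin d)} (h : Γ ⊆ I) (b : E d) :
    coordProj Γ (coordProj I b) = coordProj Γ b := by
  ext j
  by_cases hj : j ∈ Γ
  · simp [hj, h hj]
  · simp [hj]

lemma supp_coordProj_subset {d : ℕ} (I : Finset (Fin d)) (b : E d) : supp (coordProj I b) ⊆ I :=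
  supp_subset_iff.2 fun j hj => by simp [hj]

lemma inner_coordProj_comm {d : ℕ} (I : Finset (Fin d)) (a b : E d) :
    inner ℝ (coordProj I a) b = inner ℝ a (coordProj I b) := by
  rw [inner_eq_sum, inner_eq_sum]
  exact Finset.sum_congr rfl fun j _ => by by_cases h : j ∈ I <;> simp [h]

lemma inner_coordProj_self {d : ℕ} (I : Finset (Fin d)) (a : E d) :
    inner ℝ a (coordProj I a) = ‖coordProj I a‖ ^ 2 := by
  rw [inner_eq_sum, norm_sq_eq_sum]
  exact Finset.sum_congr rfl fun j _ => by by_cases h : j ∈ I <;> simp [h, sq]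

lemma inner_eq_inner_coordProj {d : ℕ} {I : Finset (Fin d)} (a : E d) {x : E d}
    (h : supp x ⊆ I) : inner ℝ a x = inner ℝ (coordProj I a) x := by
  rw [inner_coordProj_comm, coordProj_of_supp_subset h]

lemma abs_inner_le_norm_coordProj {d : ℕ} {I : Finset (Fin d)} (a : E d) {x : E d}
    (h : supp x ⊆ I) : |inner ℝ a x| ≤ ‖coordProj I a‖ * ‖x‖ := by
  rw [inner_eq_inner_coordProj a h]
  exact abs_real_inner_le_norm _ _

/-! ### Projection onto the ball -/

lemma supp_ballProj_subset {d : ℕ} (ω : ℝ) {v : E d} {I : Finset (Fin d)} (h : supp v ⊆ I) :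
    supp (ballProj ω v) ⊆ I :=
  supp_smul_subset _ h

lemma norm_ballProj_le {d : ℕ} {ω : ℝ} (hω : 0 < ω) (v : E d) : ‖ballProj ω v‖ ≤ ω := by
  have h1 : (0 : ℝ) < max 1 (‖v‖ / ω) := lt_max_of_lt_left one_pos
  rw [ballProj, norm_smul, norm_inv, Real.norm_of_nonneg h1.le, inv_mul_le_iff₀ h1]
  calc ‖v‖ = ‖v‖ / ω * ω := by field_simp
    _ ≤ _ := by gcongr; exact le_max_right _ _

lemma norm_ballProj_sub_le {d : ℕ} {ω : ℝ} (hω : 0 < ω) (v : E d) {z : E d} (hz : ‖z‖ ≤ ω) :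
    ‖ballProj ω v - z‖ ≤ ‖v - z‖ := by
  rcases le_total (‖v‖ / ω) 1 with h | h
  · rw [ballProj, max_eq_left h]; simp
  · have hv : 0 < ‖v‖ := by
      by_contra h0
      have : ‖v‖ = 0 := le_antisymm (not_lt.1 h0) (norm_nonneg _)
      rw [this] at h; norm_num at h
    have hvω : ω ≤ ‖v‖ := by rwa [one_le_div hω] at h
    rw [ballProj, max_eq_right h, inv_div]
    set c := ω / ‖v‖ with hc
    have hc1 : c ≤ 1 := (div_le_one hv).2 hvω
    have hc0 : 0 ≤ c := by positivity
    have hcv : c * ‖v‖ = ω := by rw [hc]; field_simp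
    refine le_of_sq_le_sq ?_ (norm_nonneg _)
    rw [norm_sub_sq_real, norm_sub_sq_real, norm_smul, Real.norm_of_nonneg hc0, inner_smul_left]
    simp only [conj_trivial]
    have hi : inner ℝ v z ≤ ‖v‖ * ω :=
      (real_inner_le_norm _ _).trans (by gcongr)
    have h1 : (1 - c) * inner ℝ v z ≤ (1 - c) * (‖v‖ * ω) := by
      apply mul_le_mul_of_nonneg_left hi; linarith
    have h2 : (1 - c) * (‖v‖ * ω) = ‖v‖ * ω - ω ^ 2 := by rw [← hcv]; ring
    nlinarith [sq_nonneg (‖v‖ - ω)]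

/-! ### Hard thresholding -/

lemma rhoFactor_nonneg {d k K : ℕ} (hKk : K ≤ k) (hkd : k ≤ d) : 0 ≤ rhoFactor d k K := by
  have h1 : (K : ℝ) ≤ k := by exact_mod_cast hKk
  have h2 : (k : ℝ) ≤ d := by exact_mod_cast hkd
  have h3 : (0 : ℝ) ≤ min (K : ℝ) ((d : ℝ) - k) := le_min (Nat.cast_nonneg _) (by linarith)
  unfold rhoFactor
  exact div_nonneg h3 (by linarith)

lemma one_le_nuFactor {d k K : ℕ} (hKk : K ≤ k) (hkd : k ≤ d) : 1 ≤ nuFactor d k K := by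
  have h := rhoFactor_nonneg hKk hkd
  unfold nuFactor
  have : 0 ≤ (rhoFactor d k K + √((4 + rhoFactor d k K) * rhoFactor d k K)) / 2 := by positivity
  linarith

/-- The defining quadratic equation of the expansiveness factor. -/
lemma nuFactor_sub_one_sq {d k K : ℕ} (hKk : K ≤ k) (hkd : k ≤ d) :
    (nuFactor d k K - 1) ^ 2 = rhoFactor d k K * nuFactor d k K := by
  have h := rhoFactor_nonneg hKk hkd
  have hs := Real.sq_sqrt (show 0 ≤ (4 + rhoFactor d k K) * rhoFactor d k K by positivity)
  unfold nuFactor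
  nlinarith [hs]

lemma card_mul_sum_sq_le {ι : Type*} (T R : Finset ι) (b : ι → ℝ)
    (h : ∀ j ∈ T, ∀ i ∈ R, |b j| ≤ |b i|) :
    (R.card : ℝ) * ∑ j ∈ T, b j ^ 2 ≤ T.card * ∑ i ∈ R, b i ^ 2 := by
  have : ∑ i ∈ R, ∑ j ∈ T, b j ^ 2 ≤ ∑ i ∈ R, ∑ _j ∈ T, b i ^ 2 :=
    Finset.sum_le_sum fun i hi => Finset.sum_le_sum fun j hj => sq_le_sq.2 (h j hj i hi)
  simpa [Finset.mul_sum] using this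

/-- Every entry on `Γ \ S` dominates every entry on `S \ Γ`, so the sums compare like the
cardinalities `r = |S \ Γ|` and `|Γ \ S| ≥ k - K + r`. The ratio `r / (k - K + r)` increases with
`r`, and `r ≤ min K (d - k)`. -/
lemma sum_sq_le_rhoFactor_mul {d k K : ℕ} (hKk : K ≤ k) (hkd : k ≤ d)
    {Γ S : Finset (Fin d)} (hΓ : Γ.card = k) (hS : S.card ≤ K) {b : Fin d → ℝ}
    (h : ∀ i ∈ Γ, ∀ j ∉ Γ, |b j| ≤ |b i|) :
    ∑ j ∈ S \ Γ, b j ^ 2 ≤ rhoFactor d k K * ∑ i ∈ Γ \ S, b i ^ 2 := by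
  have hρ := rhoFactor_nonneg hKk hkd
  have hQ : 0 ≤ ∑ i ∈ Γ \ S, b i ^ 2 := Finset.sum_nonneg fun _ _ => sq_nonneg _
  have hX : 0 ≤ ∑ j ∈ S \ Γ, b j ^ 2 := Finset.sum_nonneg fun _ _ => sq_nonneg _
  rcases (S \ Γ).eq_empty_or_nonempty with he | hne
  · rw [he]; simpa using mul_nonneg hρ hQ
  have hr : 1 ≤ (S \ Γ).card := hne.card_pos
  have hcard := card_mul_sum_sq_le (S \ Γ) (Γ \ S) b fun j hj i hi =>
    h i (Finset.mem_sdiff.1 hi).1 j (Finset.mem_sdiff.1 hj).2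
  have h1 : (S \ Γ).card + (S ∩ Γ).card = S.card := Finset.card_sdiff_add_card_inter S Γ
  have h2 : (Γ \ S).card + (Γ ∩ S).card = Γ.card := Finset.card_sdiff_add_card_inter Γ S
  have h3 : (S \ Γ).card + Γ.card ≤ d := by
    have := Finset.card_le_univ (S ∪ Γ)
    rw [← Finset.card_sdiff_add_card] at this
    simpa using this
  rw [Finset.inter_comm] at h2
  generalize (∑ i ∈ Γ \ S, b i ^ 2) = Q at *
  generalize (∑ j ∈ S \ Γ, b j ^ 2) = X at *
  have hR : (k : ℝ) - K + ((S \ Γ).card : ℝ) ≤ (Γ \ S).card := by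
    have : k + (S \ Γ).card ≤ (Γ \ S).card + K := by omega
    have : (k : ℝ) + (S \ Γ).card ≤ (Γ \ S).card + K := by exact_mod_cast this
    linarith
  have hp1 : ((S \ Γ).card : ℝ) ≤ min (K : ℝ) ((d : ℝ) - k) := by
    refine le_min (by exact_mod_cast (by omega)) ?_
    have : (S \ Γ).card + k ≤ d := by omega
    have : ((S \ Γ).card : ℝ) + k ≤ d := by exact_mod_cast this
    linarith
  have hr1 : (1 : ℝ) ≤ (S \ Γ).card := by exact_mod_cast hr
  have hδ : (0 : ℝ) ≤ k - K := by
    have : (K : ℝ) ≤ k := by exact_mod_cast hKk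
    linarith
  unfold rhoFactor
  generalize min (K : ℝ) ((d : ℝ) - k) = p at *
  generalize ((S \ Γ).card : ℝ) = r at *
  generalize ((Γ \ S).card : ℝ) = R at *
  generalize (k : ℝ) - K = δ at *
  have h4 : (δ + r) * X ≤ r * Q := (mul_le_mul_of_nonneg_right hR hX).trans hcard
  have h5 : X ≤ Q := by
    by_contra hlt
    push Not at hlt
    nlinarith [mul_nonneg hδ hX]
  rw [div_mul_eq_mul_div, le_div_iff₀ (by linarith)]
  nlinarith [mul_le_mul_of_nonneg_right hp1 (sub_nonneg.2 h5)]

/-- The tight bound for the expansiveness of hard thresholding. -/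
theorem norm_coordProj_sub_sq_le {d k K : ℕ} (hKk : K ≤ k) (hkd : k ≤ d)
    {Γ : Finset (Fin d)} (hΓ : Γ.card = k) {b z : E d}
    (h : ∀ i ∈ Γ, ∀ j ∉ Γ, |b j| ≤ |b i|) (hz : zeroNorm z ≤ K) :
    ‖coordProj Γ b - z‖ ^ 2 ≤ nuFactor d k K * ‖b - z‖ ^ 2 := by
  have hρ := rhoFactor_nonneg hKk hkd
  have hν := one_le_nuFactor hKk hkd
  have hquad := nuFactor_sub_one_sq hKk hkd
  have hsum := sum_sq_le_rhoFactor_mul hKk hkd hΓ (card_supp z ▸ hz) (b := fun j => b j) h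
  generalize rhoFactor d k K = ρ at *
  generalize nuFactor d k K = ν at *
  set S := supp z with hSdef
  have hzS : ∀ j, j ∉ S → z j = 0 := fun j hj => eq_zero_of_notMem_supp hj
  have e1 : ‖coordProj Γ b - z‖ ^ 2 =
      ∑ j ∈ Γ, (b j - z j) ^ 2 + ∑ j ∈ S \ Γ, z j ^ 2 := by
    rw [norm_sq_eq_sum, ← Finset.sum_add_sum_compl Γ]
    congr 1
    · exact Finset.sum_congr rfl fun j hj => by simp [hj]
    · symm
      rw [← Finset.sum_subset (s₁ := S \ Γ) (s₂ := Γᶜ)]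
      · exact Finset.sum_congr rfl fun j hj => by simp [(Finset.mem_sdiff.1 hj).2]
      · intro j hj; simpa using (Finset.mem_sdiff.1 hj).2
      · intro j hj hj'
        have h1 : j ∉ Γ := by simpa using hj
        have h2 : j ∉ S := fun hS => hj' (Finset.mem_sdiff.2 ⟨hS, h1⟩)
        simp [h1, hzS j h2]
  have e2 : ∑ j ∈ Γ, (b j - z j) ^ 2 + ∑ j ∈ S \ Γ, (b j - z j) ^ 2 ≤ ‖b - z‖ ^ 2 := by
    rw [norm_sq_eq_sum, ← Finset.sum_add_sum_compl Γ]
    refine add_le_add (le_of_eq (by simp)) ?_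
    refine (Finset.sum_le_sum_of_subset_of_nonneg (t := Γᶜ) ?_ fun _ _ _ => sq_nonneg _).trans
      (le_of_eq (by simp))
    intro j hj; simpa using (Finset.mem_sdiff.1 hj).2
  have e3 : ∑ i ∈ Γ \ S, b i ^ 2 ≤ ∑ j ∈ Γ, (b j - z j) ^ 2 := by
    refine le_trans (le_of_eq ?_) (Finset.sum_le_sum_of_subset_of_nonneg
      (Finset.sdiff_subset (s := Γ) (t := S)) fun _ _ _ => sq_nonneg _)
    exact Finset.sum_congr rfl fun j hj => by simp [hzS j (Finset.mem_sdiff.1 hj).2]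
  -- Young's inequality splits `z = b - (b - z)` with weight `ν - 1`. The resulting `b`-terms move
  -- to `Γ \ S` at the price `ρ`, and `(ν - 1)² = ρν` turns their coefficient into `ν - 1`, exactly
  -- the slack left on `Γ`. For `ν = 1` the weight degenerates, but then `b` vanishes on `S \ Γ`.
  have e4 : ∑ j ∈ S \ Γ, z j ^ 2 ≤
      ν * ∑ j ∈ S \ Γ, (b j - z j) ^ 2 + (ν - 1) * ∑ i ∈ Γ \ S, b i ^ 2 := by
    rcases eq_or_lt_of_le hν with h1 | h1
    · have hρ0 : ρ = 0 := by rw [← h1] at hquad; nlinarith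
      rw [hρ0, zero_mul] at hsum
      have hb : ∀ j ∈ S \ Γ, b j = 0 := by
        intro j hj
        have := (Finset.sum_eq_zero_iff_of_nonneg fun i _ => sq_nonneg (b i)).1
          (le_antisymm hsum (Finset.sum_nonneg fun i _ => sq_nonneg (b i))) j hj
        exact pow_eq_zero_iff (two_ne_zero) |>.1 this
      rw [← h1]
      simp only [one_mul, sub_self, zero_mul, add_zero]
      exact le_of_eq (Finset.sum_congr rfl fun j hj => by rw [hb j hj]; ring)
    · have hc : 0 < ν - 1 := by linarith
      have hpt : ∀ j ∈ S \ Γ, (ν - 1) * z j ^ 2 ≤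
          (ν - 1) * ν * (b j - z j) ^ 2 + ν * b j ^ 2 := by
        intro j _
        nlinarith [sq_nonneg (b j + (ν - 1) * (b j - z j))]
      have hs := Finset.sum_le_sum hpt
      rw [Finset.sum_add_distrib, ← Finset.mul_sum, ← Finset.mul_sum, ← Finset.mul_sum] at hs
      have hq : ν * ∑ j ∈ S \ Γ, b j ^ 2 ≤ (ν - 1) ^ 2 * ∑ i ∈ Γ \ S, b i ^ 2 := by
        rw [hquad]
        calc _ ≤ ν * (ρ * ∑ i ∈ Γ \ S, b i ^ 2) := by gcongr
          _ = _ := by ring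
      refine le_of_mul_le_mul_left ?_ hc
      linarith
  have e5 : (ν - 1) * ∑ i ∈ Γ \ S, b i ^ 2 ≤ (ν - 1) * ∑ j ∈ Γ, (b j - z j) ^ 2 :=
    mul_le_mul_of_nonneg_left e3 (by linarith)
  have e6 := mul_le_mul_of_nonneg_left e2 (show 0 ≤ ν by linarith)
  rw [e1]
  linarith

end HTSVRG

end

/-! ### Restricted gradient inequalities and the expected progress of one inner step. -/

noncomputable section

namespace HTSVRG

/-! ### Restricted smoothness and Bregman divergences -/

/-- The usual descent lemma survives the restriction because all points of the segment differ from
`x` by multiples of the same sparse vector. -/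
lemma RSS.le_add_inner {d r : ℕ} {L : ℝ} {f : E d → ℝ} (hf : RSS r L f) {x w : E d}
    (h : zeroNorm (w - x) ≤ r) :
    f w ≤ f x + inner ℝ (gradient f x) (w - x) + L / 2 * ‖w - x‖ ^ 2 := by
  set u := w - x with hu
  have hline : ∀ t : ℝ, HasDerivAt (fun t : ℝ => x + t • u) u t := fun t => by
    simpa using ((hasDerivAt_id t).smul_const u).const_add x
  have hd : ∀ t : ℝ, HasDerivAt (fun t : ℝ => f (x + t • u))
      (inner ℝ (gradient f (x + t • u)) u) t := fun t => by
    refine ((hf.1 (x + t • u)).hasGradientAt.hasFDerivAt.comp_hasDerivAt t (hline t)).congr_deriv ?_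
    simp
  let g : ℝ → ℝ := fun t => f (x + t • u) - t * inner ℝ (gradient f x) u - L / 2 * ‖u‖ ^ 2 * t ^ 2
  have hg : ∀ t : ℝ, HasDerivAt g
      (inner ℝ (gradient f (x + t • u)) u - 1 * inner ℝ (gradient f x) u
        - L / 2 * ‖u‖ ^ 2 * (2 * t)) t := fun t => by
    have h2 := ((hasDerivAt_pow 2 t).const_mul (L / 2 * ‖u‖ ^ 2))
    refine (((hd t).sub ((hasDerivAt_id t).mul_const (inner ℝ (gradient f x) u))).sub
      h2).congr_deriv ?_
    simp
  have hanti : AntitoneOn g (Set.Icc 0 1) := by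
    refine antitoneOn_of_deriv_nonpos (convex_Icc 0 1)
      (fun t _ => (hg t).continuousAt.continuousWithinAt)
      (fun t _ => (hg t).differentiableAt.differentiableWithinAt) fun t ht => ?_
    rw [interior_Icc] at ht
    rw [(hg t).deriv]
    have hsp : zeroNorm (x - (x + t • u)) ≤ r := by
      refine le_trans (zeroNorm_le_card (I := supp u) ?_) h
      have : x - (x + t • u) = (-t) • u := by rw [neg_smul]; abel
      rw [this]
      exact supp_smul_subset _ subset_rfl
    have h1 := hf.2 x (x + t • u) hsp
    rw [add_sub_cancel_left, norm_smul, Real.norm_of_nonneg ht.1.le] at h1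
    have h2 : inner ℝ (gradient f (x + t • u) - gradient f x) u ≤ L * (t * ‖u‖) * ‖u‖ :=
      (real_inner_le_norm _ _).trans (by gcongr)
    rw [inner_sub_left] at h2
    nlinarith
  have := hanti (Set.left_mem_Icc.2 zero_le_one) (Set.right_mem_Icc.2 zero_le_one) zero_le_one
  simp only [g, one_smul, zero_smul, add_zero] at this
  rw [hu, add_sub_cancel] at this
  rw [← hu] at this
  linarith

/-- The first-order characterization of convexity. -/
def FirstOrderConvex {d : ℕ} (f : E d → ℝ) : Prop :=
  ∀ x w : E d, f x + inner ℝ (gradient f x) (w - x) ≤ f w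

/-- The Bregman divergence of `f` based at `z`. -/
def bregman {d : ℕ} (f : E d → ℝ) (z x : E d) : ℝ := f x - f z - inner ℝ (gradient f z) (x - z)

lemma FirstOrderConvex.bregman_nonneg {d : ℕ} {f : E d → ℝ} (hf : FirstOrderConvex f)
    (z x : E d) : 0 ≤ bregman f z x := by
  have := hf z x
  unfold bregman
  linarith

/-- Restricted cocoercivity of the gradient of a convex function. -/
lemma RSS.norm_coordProj_gradient_sub_sq_le {d r : ℕ} {L : ℝ} {f : E d → ℝ} (hf : RSS r L f)
    (hc : FirstOrderConvex f) (hL : 0 < L) {I : Finset (Fin d)} (hI : I.card ≤ r) (z x : E d) :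
    ‖coordProj I (gradient f x - gradient f z)‖ ^ 2 ≤ 2 * L * bregman f z x := by
  -- A step of length `1 / L` from `x` along `-p` stays sparse relative to `x`: smoothness bounds
  -- its value from above, while convexity at `z`, which needs no sparsity, bounds it from below.
  set p := coordProj I (gradient f x - gradient f z) with hp
  have h1 : (x - L⁻¹ • p) - x = (-L⁻¹) • p := by rw [neg_smul]; abel
  have hsp : zeroNorm ((x - L⁻¹ • p) - x) ≤ r := by
    rw [h1]
    exact (zeroNorm_le_card (supp_smul_subset _ (supp_coordProj_subset _ _))).trans hI
  have h2 := hf.le_add_inner hsp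
  have h3 := hc z (x - L⁻¹ • p)
  have h4 : inner ℝ (gradient f x - gradient f z) p = ‖p‖ ^ 2 := inner_coordProj_self I _
  have h5 : (x - L⁻¹ • p) - z = (x - z) - L⁻¹ • p := by abel
  rw [h1, norm_smul, inner_smul_right, norm_neg, norm_inv, Real.norm_of_nonneg hL.le] at h2
  rw [h5, inner_sub_right, inner_smul_right] at h3
  rw [inner_sub_left] at h4
  unfold bregman
  have h6 : L / 2 * (L⁻¹ * ‖p‖) ^ 2 = L⁻¹ * ‖p‖ ^ 2 / 2 := by field_simp
  rw [h6] at h2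
  have h7 : L⁻¹ * (inner ℝ (gradient f x) p - inner ℝ (gradient f z) p) = L⁻¹ * ‖p‖ ^ 2 := by
    rw [h4]
  have h8 : L⁻¹ * ‖p‖ ^ 2 / 2 ≤ f x - f z - inner ℝ (gradient f z) (x - z) := by linarith
  calc ‖p‖ ^ 2 = 2 * L * (L⁻¹ * ‖p‖ ^ 2 / 2) := by field_simp
    _ ≤ _ := by gcongr

/-! ### Averages of functions -/

lemma average_eq_expect {n d : ℕ} (f : Fin n → E d → ℝ) (x : E d) :
    average f x = Finset.expect Finset.univ fun i => f i x := by
  rw [Fintype.expect_eq_sum_div_card, average, Fintype.card_fin, inv_mul_eq_div]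

lemma gradient_average {n d : ℕ} {f : Fin n → E d → ℝ} (hf : ∀ i, Differentiable ℝ (f i))
    (x : E d) : gradient (average f) x = (n : ℝ)⁻¹ • ∑ i, gradient (f i) x := by
  refine HasGradientAt.gradient ?_
  rw [hasGradientAt_iff_hasFDerivAt]
  have h : HasFDerivAt (fun x => ∑ i, f i x)
      (∑ i, InnerProductSpace.toDual ℝ (E d) (gradient (f i) x)) x :=
    HasFDerivAt.fun_sum fun i _ => (hf i x).hasGradientAt.hasFDerivAt
  refine (h.const_mul (n : ℝ)⁻¹).congr_fderiv ?_
  simp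

lemma differentiable_average {n d : ℕ} {f : Fin n → E d → ℝ} (hf : ∀ i, Differentiable ℝ (f i)) :
    Differentiable ℝ (average f) := by
  have : Differentiable ℝ fun x => ∑ i, f i x := Differentiable.fun_sum fun i _ => hf i
  exact this.const_mul _

lemma inner_gradient_average {n d : ℕ} {f : Fin n → E d → ℝ} (hf : ∀ i, Differentiable ℝ (f i))
    (x u : E d) : inner ℝ (gradient (average f) x) u =
      Finset.expect Finset.univ fun i => inner ℝ (gradient (f i) x) u := by
  rw [gradient_average hf, Fintype.expect_eq_sum_div_card, inner_smul_left, sum_inner,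
    Fintype.card_fin, div_eq_inv_mul]
  simp

lemma bregman_average {n d : ℕ} {f : Fin n → E d → ℝ} (hf : ∀ i, Differentiable ℝ (f i))
    (z x : E d) : bregman (average f) z x =
      Finset.expect Finset.univ fun i => bregman (f i) z x := by
  simp only [bregman, Finset.expect_sub_distrib, ← average_eq_expect, inner_gradient_average hf]

lemma firstOrderConvex_average {n d : ℕ} {f : Fin n → E d → ℝ}
    (hf : ∀ i, Differentiable ℝ (f i)) (hc : ∀ i, FirstOrderConvex (f i)) :
    FirstOrderConvex (average f) := by
  intro x w
  rw [inner_gradient_average hf, average_eq_expect, average_eq_expect,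
    ← Finset.expect_add_distrib]
  exact Finset.expect_le_expect fun i _ => hc i x w

lemma rss_average {n d r : ℕ} {L : ℝ} {f : Fin n → E d → ℝ} (hn : 0 < n)
    (hf : ∀ i, RSS r L (f i)) : RSS r L (average f) := by
  have hd : ∀ i, Differentiable ℝ (f i) := fun i => (hf i).1
  refine ⟨differentiable_average hd, fun x x' h => ?_⟩
  rw [gradient_average hd, gradient_average hd, ← smul_sub, ← Finset.sum_sub_distrib, norm_smul,
    norm_inv, Real.norm_natCast, inv_mul_le_iff₀ (by exact_mod_cast hn)]
  calc ‖∑ i, (gradient (f i) x' - gradient (f i) x)‖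
      ≤ ∑ _i : Fin n, L * ‖x' - x‖ := norm_sum_le_of_le _ fun i _ => (hf i).2 x x' h
    _ = _ := by simp

/-- Adding strong convexity in both directions between `0` and a unit coordinate vector. This yields
`0 < L` and `0 < 1 - η * α` later, so that both quotients in the step-size conditions are genuine.
-/
lemma RSC.le_of_rss {d r R : ℕ} {α L : ℝ} {f : E d → ℝ} (hd : 0 < d) (hr : 0 < r) (hR : 0 < R)
    (h : RSC r α f) (hL : RSS R L f) : α ≤ L := by
  obtain ⟨hα, hdiff, hsc⟩ := h
  set u : E d := EuclideanSpace.single ⟨0, hd⟩ 1 with hu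
  have hsupp : supp u ⊆ {⟨0, hd⟩} := by
    rw [supp_subset_iff]
    intro j hj
    have : j ≠ ⟨0, hd⟩ := by simpa using hj
    simp [hu, this]
  have hun : ‖u‖ = 1 := by simp [hu]
  have hz1 : zeroNorm u ≤ 1 := by simpa using zeroNorm_le_card hsupp
  have hz2 : zeroNorm (0 - u) ≤ 1 := by
    have := zeroNorm_le_card (supp_smul_subset (-1) hsupp)
    simpa using this
  have h1 := hsc u 0 (by simpa using hz1.trans hr)
  have h2 := hsc 0 u (hz2.trans hr)
  have h3 := hL.2 0 u (hz2.trans hR)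
  have h4 : inner ℝ (gradient f u - gradient f 0) u ≤ ‖gradient f u - gradient f 0‖ * ‖u‖ :=
    real_inner_le_norm _ _
  rw [inner_sub_left] at h4
  simp only [zero_sub, sub_zero, norm_neg, inner_neg_right, hun] at h1 h2 h3 h4
  linarith

/-! ### One inner step -/

/-- The deterministic hypotheses under which a stage of HT-SVRG contracts: `z` is a sparse reference
point at which the gradient of the objective is at most `G` on every sparse set of coordinates. -/
structure StageHypotheses {n d : ℕ} (f : Fin n → E d → ℝ) (k K : ℕ) (ω α L η G : ℝ) (z : E d) :
    Prop where
  n_pos : 0 < n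
  K_le : K ≤ k
  k_le : k ≤ d
  ω_pos : 0 < ω
  L_pos : 0 < L
  η_pos : 0 < η
  ηL_le : η * L ≤ 1 / 40
  G_nonneg : 0 ≤ G
  G_le : G ≤ ω * L
  convex : ∀ i, FirstOrderConvex (f i)
  rsc : RSC (k + K) α (average f)
  rss : ∀ i, RSS (3 * k + K) L (f i)
  nu_mul_le : nuFactor d k K * (1 - η * α) ≤ 1
  sparse : zeroNorm z ≤ K
  norm_le : ‖z‖ ≤ ω
  gradient_le : ∀ I : Finset (Fin d), I.card ≤ 3 * k + K →
    ‖coordProj I (gradient (average f) z)‖ ≤ G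

lemma norm_sq_sub_add_add_le {V : Type*} [NormedAddCommGroup V] (a b c g : V) :
    ‖a - b + c + g‖ ^ 2 ≤ 4 * (‖a‖ ^ 2 + ‖b‖ ^ 2 + ‖c‖ ^ 2 + ‖g‖ ^ 2) := by
  have h : ‖a - b + c + g‖ ≤ ‖a‖ + ‖b‖ + ‖c‖ + ‖g‖ := by
    refine (norm_add_le _ _).trans ?_
    gcongr
    refine (norm_add_le _ _).trans ?_
    gcongr
    exact norm_sub_le _ _
  have := pow_le_pow_left₀ (norm_nonneg _) h 2
  nlinarith [sq_nonneg (‖a‖ - ‖b‖), sq_nonneg (‖a‖ - ‖c‖), sq_nonneg (‖a‖ - ‖g‖),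
    sq_nonneg (‖b‖ - ‖c‖), sq_nonneg (‖b‖ - ‖g‖), sq_nonneg (‖c‖ - ‖g‖)]

/-- The points among which HT-SVRG moves. -/
def Feasible {d : ℕ} (k : ℕ) (ω : ℝ) (x : E d) : Prop := zeroNorm x ≤ k ∧ ‖x‖ ≤ ω

lemma Feasible.innerStep {n d k : ℕ} {f : Fin n → E d → ℝ} {H : E d → E d} {ω η : ℝ}
    (hω : 0 < ω) (hH : IsHardThresholding k H) (xt x : E d) (i : Fin n) :
    Feasible k ω (innerStep f H ω η xt x i) := by
  refine ⟨?_, norm_ballProj_le hω _⟩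
  obtain ⟨Γ, hΓ, -, hHb⟩ := hH (x - η •
    (gradient (f i) x - gradient (f i) xt + (n : ℝ)⁻¹ • ∑ l, gradient (f l) xt))
  rw [HTSVRG.innerStep, hHb]
  refine (zeroNorm_le_card (supp_ballProj_subset ω (supp_coordProj_subset Γ _))).trans ?_
  rw [hΓ]
  exact min_le_left _ _

lemma abs_inner_sub_le {d k K : ℕ} {ω G : ℝ} {g x z : E d} (hx : Feasible k ω x)
    (hz : zeroNorm z ≤ K) (hzω : ‖z‖ ≤ ω)
    (hg : ∀ I : Finset (Fin d), I.card ≤ 3 * k + K → ‖coordProj I g‖ ≤ G) :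
    |inner ℝ g (x - z)| ≤ 2 * ω * G := by
  have hI : supp (x - z) ⊆ supp x ∪ supp z :=
    supp_sub_subset Finset.subset_union_left Finset.subset_union_right
  have hcard : (supp x ∪ supp z).card ≤ 3 * k + K := by
    have := Finset.card_union_le (supp x) (supp z)
    rw [card_supp, card_supp] at this
    have := hx.1
    omega
  have hn : ‖x - z‖ ≤ 2 * ω := (norm_sub_le _ _).trans (by linarith [hx.2])
  have hG := hg _ hcard
  calc _ ≤ _ := abs_inner_le_norm_coordProj _ hI
    _ ≤ G * (2 * ω) := mul_le_mul hG hn (norm_nonneg _) ((norm_nonneg _).trans hG)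
    _ = _ := by ring

variable {n d k K : ℕ} {f : Fin n → E d → ℝ} {ω α L η G : ℝ} {z : E d}

namespace StageHypotheses

lemma differentiable (h : StageHypotheses f k K ω α L η G z) (i : Fin n) :
    Differentiable ℝ (f i) := (h.rss i).1

lemma abs_inner_gradient_le (h : StageHypotheses f k K ω α L η G z) {x : E d}
    (hx : Feasible k ω x) : |inner ℝ (gradient (average f) z) (x - z)| ≤ 2 * ω * G :=
  abs_inner_sub_le hx h.sparse h.norm_le h.gradient_le

lemma norm_sub_sq_le (h : StageHypotheses f k K ω α L η G z) {x : E d} (hx : Feasible k ω x) :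
    α / 2 * ‖x - z‖ ^ 2 ≤ bregman (average f) z x := by
  refine h.rsc.2.2 z x ((zeroNorm_sub_le z x).trans ?_)
  have := hx.1
  have := h.sparse
  omega

lemma bregman_nonneg (h : StageHypotheses f k K ω α L η G z) (x : E d) :
    0 ≤ bregman (average f) z x :=
  (firstOrderConvex_average h.differentiable h.convex).bregman_nonneg z x

/-- Only the update restricted to `I`, the union of the kept set and the three supports, matters:
`Γ` still carries the largest entries after restriction to `I`. This is where the sparsity level `3
* k + K` arises. The restricted update is then split into three gradient differences relative to
`z`, each controlled by cocoercivity, and the gradient at `z`. -/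
lemma norm_innerStep_sub_sq_le (h : StageHypotheses f k K ω α L η G z) {H : E d → E d}
    (hH : IsHardThresholding k H) {xt x : E d} (hxt : Feasible k ω xt) (hx : Feasible k ω x)
    (i : Fin n) :
    ‖innerStep f H ω η xt x i - z‖ ^ 2 ≤ nuFactor d k K * (‖x - z‖ ^ 2
      - 2 * η * (inner ℝ (gradient (f i) x) (x - z) - inner ℝ (gradient (f i) xt) (x - z)
        + inner ℝ (gradient (average f) xt) (x - z))
      + η ^ 2 * (4 * (2 * L * bregman (f i) z x + 2 * L * bregman (f i) z xt
        + 2 * L * bregman (average f) z xt + G ^ 2))) := by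
  have hgrad := gradient_average h.differentiable xt
  rw [innerStep, ← hgrad]
  set v := gradient (f i) x - gradient (f i) xt + gradient (average f) xt with hv
  obtain ⟨Γ, hΓ, htop, hHb⟩ := hH (x - η • v)
  rw [min_eq_left h.k_le] at hΓ
  set I := Γ ∪ supp x ∪ supp xt ∪ supp z with hI
  have hIcard : I.card ≤ 3 * k + K := by
    have h1 := Finset.card_union_le (Γ ∪ supp x ∪ supp xt) (supp z)
    have h2 := Finset.card_union_le (Γ ∪ supp x) (supp xt)
    have h3 := Finset.card_union_le Γ (supp x)
    rw [card_supp] at h1 h2 h3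
    rw [← hI] at h1
    have := hx.1
    have := hxt.1
    have := h.sparse
    omega
  have hΓI : Γ ⊆ I := fun j hj => by simp [hI, hj]
  have hxI : supp x ⊆ I := fun j hj => by simp [hI, hj]
  have hzI : supp z ⊆ I := fun j hj => by simp [hI, hj]
  have hxz : supp (x - z) ⊆ I := supp_sub_subset hxI hzI
  have h1 : ‖ballProj ω (H (x - η • v)) - z‖ ^ 2 ≤ ‖H (x - η • v) - z‖ ^ 2 :=
    pow_le_pow_left₀ (norm_nonneg _) (norm_ballProj_sub_le h.ω_pos _ h.norm_le) 2
  have h2 : ‖H (x - η • v) - z‖ ^ 2 ≤ nuFactor d k K * ‖coordProj I (x - η • v) - z‖ ^ 2 := by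
    rw [hHb, ← coordProj_coordProj_of_subset hΓI]
    refine norm_coordProj_sub_sq_le h.K_le h.k_le hΓ ?_ h.sparse
    intro a ha b hb
    rw [coordProj_apply, coordProj_apply, if_pos (hΓI ha)]
    by_cases hbI : b ∈ I
    · rw [if_pos hbI]; exact htop a ha b hb
    · rw [if_neg hbI, abs_zero]; exact abs_nonneg _
  have h3 : coordProj I (x - η • v) - z = (x - z) - η • coordProj I v := by
    rw [coordProj_sub, coordProj_smul, coordProj_of_supp_subset hxI]; abel
  have h4 : ‖(x - z) - η • coordProj I v‖ ^ 2 =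
      ‖x - z‖ ^ 2 - 2 * η * inner ℝ v (x - z) + η ^ 2 * ‖coordProj I v‖ ^ 2 := by
    rw [norm_sub_sq_real, inner_smul_right, real_inner_comm, ← inner_eq_inner_coordProj v hxz,
      norm_smul, mul_pow, Real.norm_eq_abs, sq_abs]
    ring
  have h5 : coordProj I v = coordProj I (gradient (f i) x - gradient (f i) z)
      - coordProj I (gradient (f i) xt - gradient (f i) z)
      + coordProj I (gradient (average f) xt - gradient (average f) z)
      + coordProj I (gradient (average f) z) := by
    rw [hv]
    simp only [coordProj_add, coordProj_sub]
    abel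
  have h6 : ‖coordProj I v‖ ^ 2 ≤ 4 * (2 * L * bregman (f i) z x + 2 * L * bregman (f i) z xt
        + 2 * L * bregman (average f) z xt + G ^ 2) := by
    rw [h5]
    refine (norm_sq_sub_add_add_le _ _ _ _).trans ?_
    gcongr
    · exact (h.rss i).norm_coordProj_gradient_sub_sq_le (h.convex i) h.L_pos hIcard z x
    · exact (h.rss i).norm_coordProj_gradient_sub_sq_le (h.convex i) h.L_pos hIcard z xt
    · exact (rss_average h.n_pos h.rss).norm_coordProj_gradient_sub_sq_le
        (firstOrderConvex_average h.differentiable h.convex) h.L_pos hIcard z xt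
    · exact h.gradient_le I hIcard
  have h7 : inner ℝ v (x - z) = inner ℝ (gradient (f i) x) (x - z)
      - inner ℝ (gradient (f i) xt) (x - z) + inner ℝ (gradient (average f) xt) (x - z) := by
    rw [hv, inner_add_left, inner_sub_left]
  have hν : 0 ≤ nuFactor d k K := zero_le_one.trans (one_le_nuFactor h.K_le h.k_le)
  rw [h3, h4, h7] at h2
  refine h1.trans (h2.trans (mul_le_mul_of_nonneg_left ?_ hν))
  gcongr

/-- The expected squared distance to the reference point after one inner step. -/
lemma expect_norm_innerStep_sub_sq_le (h : StageHypotheses f k K ω α L η G z) {H : E d → E d}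
    (hH : IsHardThresholding k H) {xt x : E d} (hxt : Feasible k ω xt) (hx : Feasible k ω x) :
    (Finset.expect Finset.univ fun i => ‖innerStep f H ω η xt x i - z‖ ^ 2) ≤
      ‖x - z‖ ^ 2 + nuFactor d k K * η * (2 / 5 * bregman (average f) z xt + 5 * ω * G
        - 9 / 5 * bregman (average f) z x) := by
  have : Nonempty (Fin n) := ⟨⟨0, h.n_pos⟩⟩
  have hle := Finset.expect_le_expect fun i (_ : i ∈ Finset.univ) =>
    h.norm_innerStep_sub_sq_le hH hxt hx i
  have hconst : ∀ c : ℝ, (Finset.expect Finset.univ fun _ : Fin n => c) = c := fun c =>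
    Fintype.expect_const c
  rw [← Finset.mul_expect] at hle
  simp only [Finset.expect_add_distrib, Finset.expect_sub_distrib, ← Finset.mul_expect,
    hconst, ← inner_gradient_average h.differentiable, ← bregman_average h.differentiable] at hle
  refine hle.trans ?_
  have hν1 := one_le_nuFactor h.K_le h.k_le
  have hD := h.bregman_nonneg x
  have hDt := h.bregman_nonneg xt
  have hsc := h.rsc.2.2 x z ((zeroNorm_sub_le x z).trans (add_le_add hx.1 h.sparse))
  have hip := (abs_le.1 (h.abs_inner_gradient_le hx)).1
  have hinner : bregman (average f) z x - 2 * ω * G + α / 2 * ‖x - z‖ ^ 2 ≤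
      inner ℝ (gradient (average f) x) (x - z) := by
    rw [← neg_sub x z, norm_neg, inner_neg_right] at hsc
    unfold bregman
    linarith
  have hη := h.η_pos
  have hηG : η * G ≤ ω / 40 := by
    have h1 : η * G ≤ η * (ω * L) := mul_le_mul_of_nonneg_left h.G_le hη.le
    have h2 : ω * (η * L) ≤ ω * (1 / 40) := mul_le_mul_of_nonneg_left h.ηL_le h.ω_pos.le
    linarith
  have hG := h.G_nonneg
  generalize bregman (average f) z x = D at *
  generalize bregman (average f) z xt = Dt at *
  generalize inner ℝ (gradient (average f) x) (x - z) = p at *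
  have h1 : η * (η * L) * D ≤ η * (1 / 40) * D := by gcongr; exact h.ηL_le
  have h2 : η * (η * L) * Dt ≤ η * (1 / 40) * Dt := by gcongr; exact h.ηL_le
  have h3 : η * G * (η * G) ≤ η * G * (ω / 40) := by gcongr
  -- With `ηL ≤ 1/40` the variance contributes `8/40` of `D`, `16/40` of `Dt` and `4/40` of `ωG`;
  -- the inner product contributes `-2D + 4ωG`. This gives `-9/5`, `2/5` and, rounded up, `5`. The
  -- two snapshot inner products cancel, the estimator being unbiased.
  have h4 : η * (D - 2 * ω * G + α / 2 * ‖x - z‖ ^ 2) ≤ η * p := by gcongr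
  have h5 : 0 ≤ η * (ω * G) := by have := h.ω_pos; positivity
  have hmain : ‖x - z‖ ^ 2 - 2 * η * (p - inner ℝ (gradient (average f) xt) (x - z)
        + inner ℝ (gradient (average f) xt) (x - z))
      + η ^ 2 * (4 * (2 * L * D + 2 * L * Dt + 2 * L * Dt + G ^ 2)) ≤
      (1 - η * α) * ‖x - z‖ ^ 2 + η * (2 / 5 * Dt + 5 * ω * G - 9 / 5 * D) := by
    linarith
  refine (mul_le_mul_of_nonneg_left hmain (by linarith)).trans ?_
  have h6 := mul_le_mul_of_nonneg_right h.nu_mul_le (sq_nonneg ‖x - z‖)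
  linarith

end StageHypotheses

end HTSVRG

end

/-! ### Averaging over the draws and contraction over the stages. -/

noncomputable section

namespace HTSVRG

/-! ### Averages over the draws -/

/-- A coordinate of a uniform random function is uniform and independent of the other ones. -/
lemma expect_apply_eq_expect_expect {ι κ : Type*} [Fintype ι] [DecidableEq ι] [Fintype κ]
    [Nonempty κ] (t : ι) (Φ : (ι → κ) → κ → ℝ)
    (hΦ : ∀ I c i, Φ (Function.update I t c) i = Φ I i) :
    (Finset.expect Finset.univ fun I => Φ I (I t)) =
      Finset.expect Finset.univ fun I => Finset.expect Finset.univ fun i => Φ I i := by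
  -- Exchanging the coordinate `t` with a fresh uniform value is an involution of the product, so it
  -- preserves averages.
  let e : (ι → κ) × κ ≃ (ι → κ) × κ :=
    { toFun := fun p => (Function.update p.1 t p.2, p.1 t)
      invFun := fun p => (Function.update p.1 t p.2, p.1 t)
      left_inv := fun p => by simp
      right_inv := fun p => by simp }
  have h1 : (Finset.expect Finset.univ fun I => Φ I (I t)) =
      Finset.expect Finset.univ fun p : (ι → κ) × κ => Φ p.1 (p.1 t) := by
    rw [← Finset.univ_product_univ, Finset.expect_product]
    exact Finset.expect_congr rfl fun I _ => (Fintype.expect_const _).symm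
  rw [h1, ← Finset.expect_product', Finset.univ_product_univ]
  exact Fintype.expect_equiv e _ _ fun p => by simp [e, hΦ]

/-- The iterate at time `t` sees only earlier draws; this makes the next index independent of it. -/
lemma innerIterate_congr {n d m : ℕ} (f : Fin n → E d → ℝ) (H : E d → E d) (ω η : ℝ) (xt : E d)
    {I I' : Fin m → Fin n} (t : ℕ) (h : ∀ r : Fin m, (r : ℕ) < t → I r = I' r) :
    innerIterate f H ω η xt I t = innerIterate f H ω η xt I' t := by
  induction t with
  | zero => rfl
  | succ t ih =>
    have ih' := ih fun r hr => h r (by omega)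
    simp only [innerIterate, ih']
    split
    · next ht => rw [h ⟨t, ht⟩ (by simp)]
    · rfl

lemma Feasible.innerIterate {n d k m : ℕ} {f : Fin n → E d → ℝ} {H : E d → E d} {ω η : ℝ}
    (hω : 0 < ω) (hH : IsHardThresholding k H) {xt : E d} (hxt : Feasible k ω xt)
    (I : Fin m → Fin n) (t : ℕ) : Feasible k ω (innerIterate f H ω η xt I t) := by
  induction t with
  | zero => exact hxt
  | succ t ih =>
    simp only [HTSVRG.innerIterate]
    split
    · exact Feasible.innerStep hω hH _ _ _
    · exact ih

lemma Feasible.iterate {n d k m : ℕ} {f : Fin n → E d → ℝ} {H : E d → E d} {ω η : ℝ}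
    (hω : 0 < ω) (hH : IsHardThresholding k H) {x0 : E d} (hx0 : Feasible k ω x0)
    (s : ℕ) (D : Fin s → Draws n m) : Feasible k ω (iterate f H ω η x0 s D) := by
  induction s with
  | zero => exact hx0
  | succ s ih => exact Feasible.innerIterate hω hH (ih _) _ _

lemma expectedValue_zero {n d : ℕ} (f : Fin n → E d → ℝ) (H : E d → E d) (ω η : ℝ) (m : ℕ)
    (x0 : E d) (φ : E d → ℝ) : expectedValue f H ω η m x0 0 φ = φ x0 := by
  simp [expectedValue, iterate]

/-- The last stage, given the previous ones. -/
lemma expectedValue_succ {n d : ℕ} (f : Fin n → E d → ℝ) (H : E d → E d) (ω η : ℝ) (m : ℕ)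
    (x0 : E d) (s : ℕ) (φ : E d → ℝ) :
    expectedValue f H ω η m x0 (s + 1) φ =
      Finset.expect Finset.univ fun D : Fin s → Draws n m =>
        Finset.expect Finset.univ fun e : Draws n m =>
          φ (innerIterate f H ω η (iterate f H ω η x0 s D) e.1 e.2) := by
  rw [Finset.expect_comm, ← Finset.expect_product', Finset.univ_product_univ, expectedValue]
  refine (Fintype.expect_equiv (Fin.snocEquiv fun _ : Fin (s + 1) => Draws n m) _ _ ?_).symm
  rintro ⟨e, D⟩
  simp [iterate, Fin.snocEquiv]

lemma nonempty_draws {n m : ℕ} (hn : 0 < n) (hm : 0 < m) : Nonempty (Draws n m) :=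
  ⟨(fun _ => ⟨0, hn⟩, ⟨0, hm⟩)⟩

variable {n d k K : ℕ} {f : Fin n → E d → ℝ} {ω α L η G : ℝ} {z : E d}

namespace StageHypotheses

/-- The expected squared distance to the reference point along the inner iterates. -/
lemma expect_norm_innerIterate_succ_sub_sq_le (h : StageHypotheses f k K ω α L η G z)
    {H : E d → E d} (hH : IsHardThresholding k H) {xt : E d} (hxt : Feasible k ω xt) {m t : ℕ}
    (ht : t < m) :
    (Finset.expect Finset.univ fun I : Fin m → Fin n =>
        ‖innerIterate f H ω η xt I (t + 1) - z‖ ^ 2) ≤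
      (Finset.expect Finset.univ fun I : Fin m → Fin n =>
        ‖innerIterate f H ω η xt I t - z‖ ^ 2) +
      nuFactor d k K * η * (2 / 5 * bregman (average f) z xt + 5 * ω * G - 9 / 5 *
        Finset.expect Finset.univ fun I : Fin m → Fin n =>
          bregman (average f) z (innerIterate f H ω η xt I t)) := by
  have : Nonempty (Fin n) := ⟨⟨0, h.n_pos⟩⟩
  have h1 : (Finset.expect Finset.univ fun I : Fin m → Fin n =>
        ‖innerIterate f H ω η xt I (t + 1) - z‖ ^ 2) =
      Finset.expect Finset.univ fun I : Fin m → Fin n => Finset.expect Finset.univ fun i =>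
        ‖innerStep f H ω η xt (innerIterate f H ω η xt I t) i - z‖ ^ 2 := by
    simp only [innerIterate, dif_pos ht]
    refine expect_apply_eq_expect_expect ⟨t, ht⟩ (fun I i =>
      ‖innerStep f H ω η xt (innerIterate f H ω η xt I t) i - z‖ ^ 2) fun I c i => ?_
    have : innerIterate f H ω η xt (Function.update I ⟨t, ht⟩ c) t =
        innerIterate f H ω η xt I t :=
      innerIterate_congr f H ω η xt t fun r hr =>
        Function.update_of_ne (fun hrt => by simp [hrt] at hr) _ _
    simp only [this]
  rw [h1]
  refine (Finset.expect_le_expect fun I _ => h.expect_norm_innerStep_sub_sq_le hH hxt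
    (Feasible.innerIterate h.ω_pos hH hxt I t)).trans (le_of_eq ?_)
  simp only [Finset.expect_add_distrib, Finset.expect_sub_distrib, ← Finset.mul_expect,
    Fintype.expect_const]

/-- One stage contracts the expected Bregman divergence to the reference point. -/
lemma expect_bregman_le (h : StageHypotheses f k K ω α L η G z) {H : E d → E d}
    (hH : IsHardThresholding k H) {xt : E d} (hxt : Feasible k ω xt) {m : ℕ}
    (hm : 20 / (η * α) ≤ m) :
    (Finset.expect Finset.univ fun e : Draws n m =>
      bregman (average f) z (innerIterate f H ω η xt e.1 e.2)) ≤
      1 / 2 * bregman (average f) z xt + 3 * ω * G := by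
  have : Nonempty (Fin n) := ⟨⟨0, h.n_pos⟩⟩
  have hα := h.rsc.1
  have hη := h.η_pos
  have hω := h.ω_pos
  have hG := h.G_nonneg
  have hm0 : (0 : ℝ) < m := lt_of_lt_of_le (by positivity) hm
  have hν1 := one_le_nuFactor h.K_le h.k_le
  have hD := h.bregman_nonneg xt
  set c := nuFactor d k K * η with hc
  set N : ℕ → ℝ := fun t => Finset.expect Finset.univ fun I : Fin m → Fin n =>
    ‖innerIterate f H ω η xt I t - z‖ ^ 2 with hN
  set B : ℕ → ℝ := fun t => Finset.expect Finset.univ fun I : Fin m → Fin n =>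
    bregman (average f) z (innerIterate f H ω η xt I t) with hB
  -- The one-step inequality telescopes; the nonnegative `N m` can then be dropped, leaving the sum
  -- that the uniform choice of `j` averages.
  have hsum : ∀ t ≤ m, N t + c * (9 / 5) * ∑ r ∈ Finset.range t, B r ≤
      ‖xt - z‖ ^ 2 + t * (c * (2 / 5 * bregman (average f) z xt + 5 * ω * G)) := by
    intro t
    induction t with
    | zero => intro _; simp [hN, innerIterate]
    | succ t ih =>
      intro ht
      have h1 := ih (by omega)
      have h2 : N (t + 1) ≤ N t + c * (2 / 5 * bregman (average f) z xt + 5 * ω * G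
          - 9 / 5 * B t) := h.expect_norm_innerIterate_succ_sub_sq_le hH hxt (by omega)
      rw [Finset.sum_range_succ]
      push_cast
      linarith
  have hE : (Finset.expect Finset.univ fun e : Draws n m =>
      bregman (average f) z (innerIterate f H ω η xt e.1 e.2)) =
      (∑ r ∈ Finset.range m, B r) / m := by
    rw [← Finset.univ_product_univ, Finset.expect_product, Finset.expect_comm,
      Fintype.expect_eq_sum_div_card, Fintype.card_fin, ← Fin.sum_univ_eq_sum_range]
  have hNm : 0 ≤ N m := Finset.expect_nonneg fun _ _ => sq_nonneg _
  have h1 := hsum m le_rfl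
  have h2 := h.norm_sub_sq_le hxt
  rw [hE, div_le_iff₀ hm0]
  generalize ∑ r ∈ Finset.range m, B r = T at *
  generalize bregman (average f) z xt = D at *
  have hcη : η ≤ c := by rw [hc]; nlinarith
  have h3 : 20 ≤ m * (η * α) := (div_le_iff₀ (by positivity)).1 hm
  have h4 : 20 ≤ m * (c * α) := h3.trans (by gcongr)
  -- The stage length pays for the initial distance: `α / 2 * ‖xt - z‖ ^ 2 ≤ D` and `20 ≤ m * (c *
  -- α)`. Together with `2/5` this makes `1/2`, and division by `9/5` leaves room below the claimed
  -- coefficients.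
  have h5 : ‖xt - z‖ ^ 2 ≤ m * c / 10 * D := by
    refine le_of_mul_le_mul_left ?_ (half_pos hα)
    refine h2.trans ?_
    have := mul_le_mul_of_nonneg_right h4 hD
    linarith
  have hcpos : 0 < c := hη.trans_le hcη
  have h6 : c * (9 / 5 * T) ≤ c * (m * (1 / 2 * D + 5 * ω * G)) := by linarith
  have h7 := le_of_mul_le_mul_left h6 hcpos
  have h8 : 0 ≤ m * (ω * G) := by positivity
  have h9 : 0 ≤ m * D := by positivity
  linarith

/-- Iterating the one-stage bound; `6 * ω * G` is the fixed point of `e ↦ e / 2 + 3 * ω * G`. -/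
lemma expectedValue_bregman_le (h : StageHypotheses f k K ω α L η G z) {H : E d → E d}
    (hH : IsHardThresholding k H) {x0 : E d} (hx0 : Feasible k ω x0) {m : ℕ}
    (hm : 20 / (η * α) ≤ m) (s : ℕ) :
    expectedValue f H ω η m x0 s (bregman (average f) z) ≤
      (1 / 2) ^ s * bregman (average f) z x0 + 6 * ω * G := by
  have hω := h.ω_pos
  have hG := h.G_nonneg
  have hm0 : 0 < m := by
    have hα := h.rsc.1
    have hη := h.η_pos
    have : (0 : ℝ) < m := lt_of_lt_of_le (by positivity) hm
    exact_mod_cast this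
  have := nonempty_draws h.n_pos hm0
  have hωG : 0 ≤ ω * G := by positivity
  induction s with
  | zero => rw [expectedValue_zero]; linarith
  | succ s ih =>
    rw [expectedValue_succ]
    refine (Finset.expect_le_expect fun D _ => h.expect_bregman_le hH
      (Feasible.iterate hω hH hx0 s D) hm).trans ?_
    rw [Finset.expect_add_distrib, ← Finset.mul_expect, Fintype.expect_const]
    change 1 / 2 * expectedValue f H ω η m x0 s (bregman (average f) z) + _ ≤ _
    rw [pow_succ]
    linarith

end StageHypotheses

lemma expectedValue_le_of_forall_feasible {n d k m : ℕ} {f : Fin n → E d → ℝ} {H : E d → E d}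
    {ω η : ℝ} (hn : 0 < n) (hm : 0 < m) (hω : 0 < ω) (hH : IsHardThresholding k H) {x0 : E d}
    (hx0 : Feasible k ω x0) (s : ℕ) {φ : E d → ℝ} {c : ℝ} (h : ∀ x, Feasible k ω x → φ x ≤ c) :
    expectedValue f H ω η m x0 s φ ≤ c := by
  have := nonempty_draws hn hm
  refine (Finset.expect_le_expect fun D _ => h _ (Feasible.iterate hω hH hx0 s D)).trans ?_
  rw [Fintype.expect_const]

/-- Linear convergence of HT-SVRG up to an error governed by the size `G`, on sparse sets of
coordinates, of the gradient at a sparse reference point `z`. -/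
theorem expectedValue_sub_le {n d k K q m : ℕ} {f : Fin n → E d → ℝ} {ω α L η G : ℝ} {z : E d}
    (hn : 0 < n) (hK : 1 ≤ K) (hKk : K ≤ k) (hkd : k ≤ d) (hω : 0 < ω) (hη : 0 < η)
    (hηL : η ≤ 1 / 40 / L) (hconv : ∀ i, FirstOrderConvex (f i))
    (hrsc : RSC (k + K) α (average f)) (hrss : ∀ i, RSS (3 * k + K) L (f i))
    (hν : nuFactor d k K ≤ 1 / (1 - η * α)) (hm : 20 / (η * α) ≤ m)
    (hz : zeroNorm z ≤ K) (hzω : ‖z‖ ≤ ω) (hG : 0 ≤ G)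
    (hgrad : ∀ I : Finset (Fin d), I.card ≤ 3 * k + K →
      ‖coordProj I (gradient (average f) z)‖ ≤ G)
    {H : E d → E d} (hH : IsHardThresholding k H) {x0 : E d} (hx0 : Feasible k ω x0)
    (hq : q = K ∨ q = k) {xh : E d} (hxh : IsSparseOptimum q ω (average f) xh) (s : ℕ) :
    expectedValue f H ω η m x0 s (average f) - average f xh ≤
      (1 / 2) ^ s * (average f x0 - average f xh) + 12 * ω * G := by
  have hα := hrsc.1
  have hdiff : ∀ i, Differentiable ℝ (f i) := fun i => (hrss i).1
  have hm0 : 0 < m := by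
    have : (0 : ℝ) < m := lt_of_lt_of_le (by positivity) hm
    exact_mod_cast this
  have hFrss := rss_average hn hrss
  have hFconv := firstOrderConvex_average hdiff hconv
  have hαL : α ≤ L := hrsc.le_of_rss (by omega) (by omega) (by omega) hFrss
  have hL : 0 < L := hα.trans_le hαL
  have hηL' : η * L ≤ 1 / 40 := (le_div_iff₀ hL).1 hηL
  have hηα : η * α ≤ 1 / 40 := (mul_le_mul_of_nonneg_left hαL hη.le).trans hηL'
  have hinner : ∀ x, Feasible k ω x → |inner ℝ (gradient (average f) z) (x - z)| ≤ 2 * ω * G :=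
    fun x hx => abs_inner_sub_le hx hz hzω hgrad
  have hxhf : Feasible k ω xh := ⟨hxh.1.trans (by omega), hxh.2.1⟩
  have hlow : ∀ x, Feasible k ω x → average f z - 2 * ω * G ≤ average f x := fun x hx => by
    have h1 := hFconv z x
    have h2 := (abs_le.1 (hinner x hx)).1
    linarith
  have hopt : average f xh ≤ average f z := hxh.2.2 z (hz.trans (by omega)) hzω
  have hpow : (0 : ℝ) ≤ (1 / 2) ^ s := by positivity
  have hpow1 : (1 / 2 : ℝ) ^ s ≤ 1 := pow_le_one₀ (by norm_num) (by norm_num)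
  have hωG : 0 ≤ ω * G := by positivity
  -- If `G ≤ ωL`, the quadratic term `η²G²` is dominated by `ηωG` and the stages contract. Otherwise
  -- `G` is so large that the oscillation of `F` over feasible points is already of order `ωG`.
  rcases le_or_gt G (ω * L) with hGL | hGL
  · have hyp : StageHypotheses f k K ω α L η G z :=
      { n_pos := hn, K_le := hKk, k_le := hkd, ω_pos := hω, L_pos := hL, η_pos := hη
        ηL_le := hηL', G_nonneg := hG, G_le := hGL, convex := hconv, rsc := hrsc, rss := hrss
        nu_mul_le := (le_div_iff₀ (by linarith)).1 hν
        sparse := hz, norm_le := hzω, gradient_le := hgrad }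
    have h1 := hyp.expectedValue_bregman_le hH hx0 hm s
    have h2 : expectedValue f H ω η m x0 s (average f) ≤
        expectedValue f H ω η m x0 s (bregman (average f) z) + (average f z + 2 * ω * G) := by
      have := nonempty_draws hn hm0
      have hpt : expectedValue f H ω η m x0 s (average f) ≤ expectedValue f H ω η m x0 s
          fun x => bregman (average f) z x + (average f z + 2 * ω * G) := by
        refine Finset.expect_le_expect fun D _ => ?_
        have := (abs_le.1 (hinner _ (Feasible.iterate (f := f) (η := η) hω hH hx0 s D))).2
        unfold bregman
        linarith
      refine hpt.trans (le_of_eq ?_)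
      rw [expectedValue, Finset.expect_add_distrib, Fintype.expect_const, expectedValue]
    have h3 : bregman (average f) z x0 ≤ average f x0 - average f xh + 2 * ω * G := by
      have := (abs_le.1 (hinner x0 hx0)).1
      unfold bregman
      linarith
    have h4 := mul_le_mul_of_nonneg_left h3 hpow
    have h5 : (1 / 2 : ℝ) ^ s * (2 * ω * G) ≤ 1 * (2 * ω * G) := by
      gcongr
    -- The constant is `12 = 6 + 2 + 2 + 2`: the stages, the passage from Bregman divergence to `F`
    -- at the output and at the start, and `F z` against `F xh`.
    have h6 := hlow xh hxhf
    linarith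
  · have h1 : ∀ x, Feasible k ω x → average f x ≤ average f z + 4 * ω * G := fun x hx => by
      have hsp : zeroNorm (x - z) ≤ 3 * k + K :=
        (zeroNorm_sub_le x z).trans (by have := hx.1; omega)
      have h1 := hFrss.le_add_inner hsp
      have h2 := (abs_le.1 (hinner x hx)).2
      have hnorm : ‖x - z‖ ≤ 2 * ω := (norm_sub_le _ _).trans (by linarith [hx.2])
      have h3 : L / 2 * ‖x - z‖ ^ 2 ≤ L / 2 * (2 * ω) ^ 2 := by gcongr
      have h4 := mul_le_mul_of_nonneg_left hGL.le hω.le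
      linarith
    have h2 := expectedValue_le_of_forall_feasible (f := f) (η := η) hn hm0 hω hH hx0 s h1
    have h3 := hlow x0 hx0
    have h4 := hlow xh hxhf
    have h5 : (1 / 2 : ℝ) ^ s * (-(2 * ω * G)) ≤ (1 / 2) ^ s * (average f x0 - average f xh) := by
      gcongr
      linarith
    have h6 : (1 / 2 : ℝ) ^ s * (2 * ω * G) ≤ 1 * (2 * ω * G) := by
      gcongr
    linarith

end HTSVRG

end

/-! ### The logistic loss and sub-Gaussian concentration. -/

noncomputable section

namespace HTSVRG

/-! ### The logistic loss -/

/-- The derivative of `s ↦ log (1 + exp (-2 v s))`. -/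
def logisticDeriv (v s : ℝ) : ℝ := -2 * v * Real.exp (-2 * v * s) / (1 + Real.exp (-2 * v * s))

lemma hasDerivAt_logistic (v s : ℝ) :
    HasDerivAt (fun s => Real.log (1 + Real.exp (-2 * v * s))) (logisticDeriv v s) s := by
  have h1 : HasDerivAt (fun s : ℝ => 1 + Real.exp (-2 * v * s))
      (Real.exp (-2 * v * s) * (-2 * v)) s := by
    have h := ((hasDerivAt_id s).const_mul (-2 * v)).exp.const_add 1
    simpa using h
  have h2 := h1.log (by positivity)
  rwa [mul_comm (Real.exp _)] at h2

lemma abs_logisticDeriv_le (v s : ℝ) : |logisticDeriv v s| ≤ 2 * |v| := by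
  have he := Real.exp_pos (-2 * v * s)
  rw [logisticDeriv, abs_div, abs_mul, abs_mul, abs_of_pos he,
    abs_of_pos (show 0 < 1 + Real.exp (-2 * v * s) by linarith), div_le_iff₀ (by linarith)]
  have := abs_nonneg v
  norm_num
  nlinarith

/-- Convexity of `exp` with the logistic weights `p` and `1 - p`, followed by a logarithm. -/
lemma logistic_add_logisticDeriv_mul_le (v s s' : ℝ) :
    Real.log (1 + Real.exp (-2 * v * s)) + logisticDeriv v s * (s' - s) ≤
      Real.log (1 + Real.exp (-2 * v * s')) := by
  set e := Real.exp (-2 * v * s) with he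
  have he0 : 0 < e := Real.exp_pos _
  set p := e / (1 + e) with hp
  have hp0 : 0 ≤ p := by positivity
  have hp1 : 1 - p = 1 / (1 + e) := by rw [hp]; field_simp; ring
  have hp1' : 0 ≤ 1 - p := by rw [hp1]; positivity
  have hconv := convexOn_exp.2 (Set.mem_univ (-2 * v * (s' - s))) (Set.mem_univ 0) hp0 hp1'
    (by ring)
  simp only [smul_eq_mul, mul_zero, add_zero, Real.exp_zero, mul_one] at hconv
  have h1 : Real.exp (-2 * v * s') = e * Real.exp (-2 * v * (s' - s)) := by
    rw [he, ← Real.exp_add]; ring_nf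
  have h2 : (1 + e) * Real.exp (p * (-2 * v * (s' - s))) ≤ 1 + Real.exp (-2 * v * s') := by
    rw [h1]
    calc _ ≤ (1 + e) * (p * Real.exp (-2 * v * (s' - s)) + (1 - p)) := by gcongr
      _ = _ := by rw [hp1, hp]; field_simp; ring
  have h3 := Real.log_le_log (by positivity) h2
  rw [Real.log_mul (by positivity) (Real.exp_ne_zero _), Real.log_exp] at h3
  have h4 : logisticDeriv v s = p * (-2 * v) := by rw [logisticDeriv, hp, ← he]; ring
  rw [h4]
  linarith

lemma measurable_logisticDeriv : Measurable fun q : ℝ × ℝ => logisticDeriv q.1 q.2 := by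
  unfold logisticDeriv
  fun_prop

lemma hasGradientAt_logisticLoss {d : ℕ} (γ : ℝ) (a : E d) (v : ℝ) (x : E d) :
    HasGradientAt (logisticLoss γ a v) (logisticDeriv v (inner ℝ a x) • a + γ • x) x := by
  rw [hasGradientAt_iff_hasFDerivAt]
  have h1 : HasFDerivAt (fun x : E d => inner ℝ a x) (innerSL ℝ a) x := (innerSL ℝ a).hasFDerivAt
  have h2 := (hasDerivAt_logistic v (inner ℝ a x)).comp_hasFDerivAt x h1
  have h3 := ((hasStrictFDerivAt_norm_sq x).hasFDerivAt).const_mul (γ / 2)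
  refine (h2.add h3).congr_fderiv ?_
  ext u
  simp
  ring

lemma gradient_logisticLoss {d : ℕ} (γ : ℝ) (a : E d) (v : ℝ) (x : E d) :
    gradient (logisticLoss γ a v) x = logisticDeriv v (inner ℝ a x) • a + γ • x :=
  (hasGradientAt_logisticLoss γ a v x).gradient

lemma differentiable_logisticLoss {d : ℕ} (γ : ℝ) (a : E d) (v : ℝ) :
    Differentiable ℝ (logisticLoss γ a v) :=
  fun x => (hasGradientAt_logisticLoss γ a v x).differentiableAt

lemma firstOrderConvex_logisticLoss {d : ℕ} {γ : ℝ} (hγ : 0 ≤ γ) (a : E d) (v : ℝ) :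
    FirstOrderConvex (logisticLoss γ a v) := by
  intro x w
  rw [gradient_logisticLoss, inner_add_left, inner_smul_left, inner_smul_left, inner_sub_right]
  simp only [conj_trivial, logisticLoss]
  have h1 := logistic_add_logisticDeriv_mul_le v (inner ℝ a x) (inner ℝ a w)
  have h2 : γ / 2 * ‖x‖ ^ 2 + γ * inner ℝ x (w - x) + γ / 2 * ‖w - x‖ ^ 2 = γ / 2 * ‖w‖ ^ 2 := by
    have : w = x + (w - x) := by abel
    conv_rhs => rw [this, norm_add_sq_real]
    ring
  have h3 : 0 ≤ γ / 2 * ‖w - x‖ ^ 2 := by positivity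
  linarith

/-! ### Sub-Gaussian random variables -/

/-- By `cosh (p + q) + cosh (p - q) = 2 cosh p cosh q` and `1 ≤ cosh`. The `+ 1` on the left later
removes the factor 2 from a moment generating function bound. -/
lemma cosh_sub_add_one_le {x y p q : ℝ} (hx : |x| ≤ |p|) (hy : |y| ≤ |q|) :
    Real.cosh (x - y) + 1 ≤ 2 * (Real.cosh p * Real.cosh q) := by
  have h1 : Real.cosh (x - y) ≤ Real.cosh (|p| + |q|) := by
    rw [Real.cosh_le_cosh, abs_of_nonneg (by positivity : 0 ≤ |p| + |q|)]
    exact (abs_sub _ _).trans (add_le_add hx hy)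
  have h2 := Real.one_le_cosh (|p| - |q|)
  rw [Real.cosh_add] at h1
  rw [Real.cosh_sub] at h2
  rw [← Real.cosh_abs p, ← Real.cosh_abs q]
  linarith

variable {Ω : Type*} [MeasurableSpace Ω] {μ : Measure Ω}

/-- A random variable dominated by a sub-Gaussian one is sub-Gaussian after centering. -/
lemma hasSubgaussianMGF_sub_integral [IsProbabilityMeasure μ] {X a : Ω → ℝ} {c : NNReal}
    (ha : HasSubgaussianMGF a c μ) (hX : AEMeasurable X μ) (h : ∀ w, |X w| ≤ 2 * |a w|) :
    HasSubgaussianMGF (fun w => X w - ∫ w, X w ∂μ) (16 * c) μ := by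
  have hXint : Integrable X μ := by
    refine Integrable.mono' (ha.integrable.abs.const_mul 2) hX.aestronglyMeasurable ?_
    exact Filter.Eventually.of_forall h
  have hcosha : ∀ t : ℝ, Integrable (fun w => Real.cosh (2 * t * a w)) μ := by
    intro t
    simp only [Real.cosh_eq]
    have h2 := ha.integrable_exp_mul (-(2 * t))
    simp only [neg_mul] at h2
    exact ((ha.integrable_exp_mul (2 * t)).add h2).div_const 2
  have hexp : ∀ t : ℝ, Integrable (fun w => Real.exp (t * X w)) μ := by
    intro t
    refine Integrable.mono' ((hcosha t).const_mul 2)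
      (by fun_prop) (Filter.Eventually.of_forall fun w => ?_)
    rw [Real.norm_of_nonneg (Real.exp_pos _).le]
    have h1 : Real.exp (t * X w) ≤ 2 * Real.cosh (t * X w) := by
      rw [Real.cosh_eq]
      have := Real.exp_pos (-(t * X w))
      linarith
    refine h1.trans ?_
    gcongr
    rw [Real.cosh_le_cosh, mul_comm 2 t, mul_assoc, abs_mul, abs_mul t, abs_mul 2]
    gcongr
    simpa using h w
  have hcosh : ∀ t : ℝ, Integrable (fun w => Real.cosh (t * X w)) μ := by
    intro t
    simp only [Real.cosh_eq]
    have h2 := hexp (-t)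
    simp only [neg_mul] at h2
    exact ((hexp t).add h2).div_const 2
  have hsinh : ∀ t : ℝ, Integrable (fun w => Real.sinh (t * X w)) μ := by
    intro t
    simp only [Real.sinh_eq]
    have h2 := hexp (-t)
    simp only [neg_mul] at h2
    exact ((hexp t).sub h2).div_const 2
  refine ⟨fun t => ?_, fun t => ?_⟩
  · simp only [mul_sub, Real.exp_sub]
    exact (hexp t).div_const _
  -- Symmetrization: by Jensen the centered moment generating function is at most `(C + S) * (C -
  -- S)`, which is the mean of `cosh (t * (X - X'))` for an independent copy `X'` of `X`.
  set C := ∫ w, Real.cosh (t * X w) ∂μ with hC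
  set S := ∫ w, Real.sinh (t * X w) ∂μ with hS
  set Ca := ∫ w, Real.cosh (2 * t * a w) ∂μ with hCa
  have hpt : ∀ w w', Real.cosh (t * X w) * Real.cosh (t * X w')
      - Real.sinh (t * X w) * Real.sinh (t * X w') + 1 ≤
        2 * (Real.cosh (2 * t * a w) * Real.cosh (2 * t * a w')) := by
    intro w w'
    rw [← Real.cosh_sub]
    have key : ∀ w, |t * X w| ≤ |2 * t * a w| := fun w => by
      rw [mul_comm 2 t, mul_assoc, abs_mul, abs_mul t, abs_mul 2]
      gcongr
      simpa using h w
    exact cosh_sub_add_one_le (key w) (key w')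
  -- Integrating one variable at a time, used twice, replaces the product measure of the independent
  -- copy.
  have hlin : ∀ p q r : ℝ, (∀ w, p * Real.cosh (t * X w) - q * Real.sinh (t * X w) + 1 ≤
      2 * (r * Real.cosh (2 * t * a w))) → p * C - q * S + 1 ≤ 2 * (r * Ca) := by
    intro p q r hle
    have i1 : Integrable (fun w => p * Real.cosh (t * X w) - q * Real.sinh (t * X w)) μ :=
      ((hcosh t).const_mul p).sub ((hsinh t).const_mul q)
    have h1 := integral_mono (μ := μ) (i1.add (integrable_const 1))
      (((hcosha t).const_mul r).const_mul 2) hle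
    simp only [Pi.add_apply] at h1
    rw [integral_add i1 (integrable_const 1), integral_sub ((hcosh t).const_mul p)
      ((hsinh t).const_mul q), integral_const_mul, integral_const_mul, integral_const_mul,
      integral_const_mul] at h1
    simpa using h1
  have hstep : ∀ w', C * Real.cosh (t * X w') - S * Real.sinh (t * X w') + 1 ≤
      2 * (Ca * Real.cosh (2 * t * a w')) := by
    intro w'
    rw [mul_comm C, mul_comm S, mul_comm Ca]
    refine hlin _ _ _ fun w => (le_of_eq ?_).trans ((hpt w w').trans (le_of_eq ?_)) <;> ring
  have hprod : C * C - S * S + 1 ≤ 2 * (Ca * Ca) := hlin C S Ca hstep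
  have hCa0 : 0 ≤ Ca := integral_nonneg fun w => (Real.cosh_pos _).le
  have hCale : Ca ≤ Real.exp (2 * c * t ^ 2) := by
    have h1 : Ca = (mgf a μ (2 * t) + mgf a μ (-(2 * t))) / 2 := by
      rw [hCa, mgf, mgf, ← integral_add (ha.integrable_exp_mul _) (ha.integrable_exp_mul _),
        ← integral_div]
      simp only [Real.cosh_eq, neg_mul]
    have h2 := ha.mgf_le (2 * t)
    have h3 := ha.mgf_le (-(2 * t))
    have h4 : (c : ℝ) * (2 * t) ^ 2 / 2 = 2 * c * t ^ 2 := by ring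
    have h5 : (c : ℝ) * (-(2 * t)) ^ 2 / 2 = 2 * c * t ^ 2 := by ring
    rw [h4] at h2
    rw [h5] at h3
    linarith
  have hplus : ∫ w, Real.exp (t * X w) ∂μ = C + S := by
    rw [hC, hS, ← integral_add (hcosh t) (hsinh t)]
    simp only [Real.cosh_add_sinh]
  have hminus : ∫ w, Real.exp (-(t * X w)) ∂μ = C - S := by
    rw [hC, hS, ← integral_sub (hcosh t) (hsinh t)]
    simp only [Real.cosh_sub_sinh]
  have hjensen : Real.exp (-(t * ∫ w, X w ∂μ)) ≤ C - S := by
    have hint : Integrable (fun w => Real.exp (-(t * X w))) μ := by simpa using hexp (-t)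
    have h1 := convexOn_exp.map_integral_le (μ := μ) (f := fun w => -(t * X w))
      Real.continuous_exp.continuousOn isClosed_univ
      (Filter.Eventually.of_forall fun _ => Set.mem_univ _) (hXint.const_mul t).neg hint
    simp only [integral_neg, integral_const_mul] at h1
    exact h1.trans_eq hminus
  have hmgf : mgf (fun w => X w - ∫ w, X w ∂μ) μ t = Real.exp (-(t * ∫ w, X w ∂μ)) * (C + S) := by
    rw [mgf, ← hplus, ← integral_const_mul]
    refine integral_congr_ae (Filter.Eventually.of_forall fun w => ?_)
    simp only [← Real.exp_add]
    ring_nf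
  have hCS : 0 ≤ C + S := hplus ▸ integral_nonneg fun w => (Real.exp_pos _).le
  rw [hmgf]
  have h1 : Real.exp (-(t * ∫ w, X w ∂μ)) * (C + S) ≤ (C - S) * (C + S) := by gcongr
  have h2 : Ca * Ca ≤ Real.exp (4 * c * t ^ 2) := by
    calc Ca * Ca ≤ Real.exp (2 * c * t ^ 2) * Real.exp (2 * c * t ^ 2) := by gcongr
      _ = _ := by rw [← Real.exp_add]; ring_nf
  have h3 : Real.exp (((16 * c : NNReal) : ℝ) * t ^ 2 / 2) = Real.exp (4 * c * t ^ 2) ^ 2 := by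
    rw [← Real.exp_nat_mul]; push_cast; ring_nf
  rw [h3]
  -- With `u = exp (4ct²)` the bound so far is `2u - 1 ≤ u²`, and `u²` is the moment bound for
  -- variance proxy `16c`.
  nlinarith [sq_nonneg (Real.exp (4 * c * t ^ 2) - 1)]

/-- Concentration of a sum of independent random variables dominated by sub-Gaussian ones. -/
lemma measureReal_abs_sum_ge_le [IsProbabilityMeasure μ] {n : ℕ} {X a : Fin n → Ω → ℝ}
    {σ : ℝ} (ha : ∀ i, HasSubgaussianMGF (a i) (Real.toNNReal (σ ^ 2)) μ)
    (hX : ∀ i, Measurable (X i)) (h : ∀ i w, |X i w| ≤ 2 * |a i w|) (hind : iIndepFun X μ)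
    {ε : ℝ} (hε : 0 ≤ ε) :
    μ.real {w | ε ≤ |∑ i, (X i w - ∫ w, X i w ∂μ)|} ≤
      2 * Real.exp (-(ε ^ 2 / (32 * n * σ ^ 2))) := by
  have hsub : ∀ i, HasSubgaussianMGF (fun w => X i w - ∫ w, X i w ∂μ)
      (16 * Real.toNNReal (σ ^ 2)) μ :=
    fun i => hasSubgaussianMGF_sub_integral (ha i) (hX i).aemeasurable (h i)
  have hind1 : iIndepFun (fun i w => X i w - ∫ w, X i w ∂μ) μ :=
    hind.comp (fun i x => x - ∫ w, X i w ∂μ) fun i => by fun_prop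
  have hind2 : iIndepFun (fun i => -(fun w => X i w - ∫ w, X i w ∂μ)) μ :=
    hind.comp (fun i x => -(x - ∫ w, X i w ∂μ)) fun i => by fun_prop
  have h1 := HasSubgaussianMGF.measure_sum_ge_le_of_iIndepFun hind1
    (s := Finset.univ) (fun i _ => hsub i) hε
  have h2 := HasSubgaussianMGF.measure_sum_ge_le_of_iIndepFun hind2
    (s := Finset.univ) (fun i _ => (hsub i).neg) hε
  have hexp : -ε ^ 2 / (2 * ((∑ _i : Fin n, 16 * Real.toNNReal (σ ^ 2) : NNReal) : ℝ)) =
      -(ε ^ 2 / (32 * n * σ ^ 2)) := by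
    rw [Finset.sum_const, Finset.card_univ, Fintype.card_fin]
    push_cast
    rw [nsmul_eq_mul]
    rw [Real.coe_toNNReal _ (sq_nonneg σ), neg_div]
    congr 2
    ring
  rw [hexp] at h1 h2
  have hsubset : {w | ε ≤ |∑ i, (X i w - ∫ w, X i w ∂μ)|} ⊆
      {w | ε ≤ ∑ i, (X i w - ∫ w, X i w ∂μ)} ∪
        {w | ε ≤ ∑ i, (-(fun w => X i w - ∫ w, X i w ∂μ)) w} := by
    intro w hw
    rcases le_abs.1 (show ε ≤ |∑ i, (X i w - ∫ w, X i w ∂μ)| from hw) with h' | h'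
    · exact Or.inl h'
    · right
      simpa [Finset.sum_neg_distrib] using h'
  calc _ ≤ _ := measureReal_mono hsubset
    _ ≤ _ := measureReal_union_le _ _
    _ ≤ _ := by linarith

end HTSVRG

end

/-! ### The population score and the reference point. -/

noncomputable section

namespace HTSVRG

/-! ### The score of the logistic model -/

/-- The expectation of `logisticDeriv y s'` when the label `y` is drawn with parameter `s`. -/
def meanLogisticDeriv (s s' : ℝ) : ℝ :=
  Real.exp (2 * 1 * s) / (1 + Real.exp (2 * 1 * s)) * logisticDeriv 1 s' +
    Real.exp (2 * -1 * s) / (1 + Real.exp (2 * -1 * s)) * logisticDeriv (-1) s'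

lemma meanLogisticDeriv_self (s : ℝ) : meanLogisticDeriv s s = 0 := by
  have h1 : Real.exp (2 * -1 * s) = (Real.exp (2 * s))⁻¹ := by rw [← Real.exp_neg]; ring_nf
  have h2 : Real.exp (-2 * 1 * s) = (Real.exp (2 * s))⁻¹ := by rw [← Real.exp_neg]; ring_nf
  have h3 : Real.exp (-2 * -1 * s) = Real.exp (2 * s) := by ring_nf
  unfold meanLogisticDeriv logisticDeriv
  rw [h1, h2, h3, mul_one]
  have := Real.exp_pos (2 * s)
  field_simp
  ring

lemma measurable_meanLogisticDeriv : Measurable fun q : ℝ × ℝ => meanLogisticDeriv q.1 q.2 := by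
  unfold meanLogisticDeriv logisticDeriv
  fun_prop

lemma abs_logistic_sub_le (v s s' : ℝ) :
    |Real.log (1 + Real.exp (-2 * v * s)) - Real.log (1 + Real.exp (-2 * v * s'))| ≤
      2 * |v| * |s - s'| := by
  have key : ∀ s s' : ℝ,
      Real.log (1 + Real.exp (-2 * v * s)) - Real.log (1 + Real.exp (-2 * v * s')) ≤
      2 * |v| * |s - s'| := fun s s' => by
    have h1 := logistic_add_logisticDeriv_mul_le v s s'
    have h2 : |logisticDeriv v s * (s' - s)| ≤ 2 * |v| * |s - s'| := by
      rw [abs_mul, abs_sub_comm s']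
      gcongr
      exact abs_logisticDeriv_le v s
    linarith [(abs_le.1 h2).1]
  rw [abs_le]
  have h2 := key s' s
  rw [abs_sub_comm s' s] at h2
  exact ⟨by linarith, key s s'⟩

/-- The `j`-th coordinate of the gradient at `z` of the unregularized loss of a sample. -/
def score {d : ℕ} (j : Fin d) (z : E d) (p : E d × ℝ) : ℝ :=
  logisticDeriv p.2 (inner ℝ p.1 z) * p.1 j

lemma measurable_score {d : ℕ} (j : Fin d) (z : E d) : Measurable (score j z) := by
  have h : Measurable fun p : E d × ℝ => logisticDeriv p.2 (inner ℝ p.1 z) :=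
    measurable_logisticDeriv.comp (f := fun p : E d × ℝ => (p.2, (inner ℝ p.1 z : ℝ)))
      (by fun_prop)
  unfold score
  fun_prop

namespace IsLogisticModel

variable {n d : ℕ} {Ω : Type*} [MeasurableSpace Ω] {μ : Measure Ω}
  {σ : ℝ} {xs : E d} {A : Fin n → Ω → E d} {y : Fin n → Ω → ℝ}

lemma abs_label (h : IsLogisticModel μ σ xs A y) (i : Fin n) (w : Ω) : |y i w| = 1 := by
  rcases h.label_values i w with hy | hy <;> simp [hy]

lemma measurable_entry (h : IsLogisticModel μ σ xs A y) (i : Fin n) (j : Fin d) :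
    Measurable fun w => A i w j := by
  have := h.measurable_design i
  fun_prop

lemma integrable_entry (h : IsLogisticModel μ σ xs A y) (i : Fin n) (j : Fin d) :
    Integrable (fun w => A i w j) μ :=
  (h.subGaussian i j).integrable

lemma abs_score_le (h : IsLogisticModel μ σ xs A y) (i : Fin n) (j : Fin d) (z : E d) (w : Ω) :
    |score j z (A i w, y i w)| ≤ 2 * |A i w j| := by
  rw [score, abs_mul]
  gcongr
  simpa [h.abs_label] using abs_logisticDeriv_le (y i w) (inner ℝ (A i w) z)

lemma measurable_score (h : IsLogisticModel μ σ xs A y) (i : Fin n) (j : Fin d) (z : E d) :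
    Measurable fun w => score j z (A i w, y i w) :=
  (HTSVRG.measurable_score j z).comp ((h.measurable_design i).prodMk (h.measurable_label i))

lemma integrable_score (h : IsLogisticModel μ σ xs A y) (i : Fin n) (j : Fin d) (z : E d) :
    Integrable (fun w => score j z (A i w, y i w)) μ :=
  Integrable.mono' ((h.integrable_entry i j).abs.const_mul 2)
    (h.measurable_score i j z).aestronglyMeasurable
    (Filter.Eventually.of_forall (h.abs_score_le i j z))

/-- Integration of a function of the design on the event that the label takes a given value. -/
lemma integral_mul_indicator [IsProbabilityMeasure μ] (h : IsLogisticModel μ σ xs A y) (i : Fin n) {v : ℝ}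
    (hv : v = 1 ∨ v = -1) {φ : E d → ℝ} (hφ : Measurable φ)
    (hint : Integrable (fun w => φ (A i w)) μ) :
    Integrable (fun w => φ (A i w) * Set.indicator {w | y i w = v} (fun _ => (1 : ℝ)) w) μ ∧
    Integrable (fun w => φ (A i w) * (Real.exp (2 * v * inner ℝ (A i w) xs) /
        (1 + Real.exp (2 * v * inner ℝ (A i w) xs)))) μ ∧
    ∫ w, φ (A i w) * Set.indicator {w | y i w = v} (fun _ => (1 : ℝ)) w ∂μ =
      ∫ w, φ (A i w) * (Real.exp (2 * v * inner ℝ (A i w) xs) /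
        (1 + Real.exp (2 * v * inner ℝ (A i w) xs))) ∂μ := by
  have hset : MeasurableSet {w | y i w = v} := h.measurable_label i (measurableSet_singleton v)
  have hg : Integrable (Set.indicator {w | y i w = v} fun _ => (1 : ℝ)) μ :=
    (integrable_const 1).indicator hset
  have hfg : Integrable ((fun w => φ (A i w)) *
      Set.indicator {w | y i w = v} fun _ => (1 : ℝ)) μ := by
    refine Integrable.mono' hint.abs (hint.1.mul hg.1) (Filter.Eventually.of_forall fun w => ?_)
    rw [Pi.mul_apply, norm_mul]
    refine mul_le_of_le_one_right (abs_nonneg _) ?_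
    by_cases hw : w ∈ {w | y i w = v} <;> simp [hw]
  have hf : StronglyMeasurable[MeasurableSpace.comap (A i) inferInstance]
      (fun w => φ (A i w)) :=
    (hφ.comp (comap_measurable (A i))).stronglyMeasurable
  have h1 := condExp_mul_of_stronglyMeasurable_left hf hfg hg
  have h2 : μ[(fun w => φ (A i w)) * Set.indicator {w | y i w = v} (fun _ => (1 : ℝ)) |
      MeasurableSpace.comap (A i) inferInstance] =ᵐ[μ] fun w => φ (A i w) *
        (Real.exp (2 * v * inner ℝ (A i w) xs) /
          (1 + Real.exp (2 * v * inner ℝ (A i w) xs))) := by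
    filter_upwards [h1, h.label_law i v hv] with w hw1 hw2
    rw [hw1, Pi.mul_apply, hw2]
  refine ⟨hfg, integrable_condExp.congr h2, ?_⟩
  rw [← integral_congr_ae h2, integral_condExp (h.measurable_design i).comap_le]
  rfl

/-- Conditioning on the design replaces the indicators of the two label values by their
probabilities. What remains depends on the design only through two inner products and the entry `j`.
-/
lemma integral_score [IsProbabilityMeasure μ] (h : IsLogisticModel μ σ xs A y)
    (i : Fin n) (j : Fin d) (z : E d) :
    ∫ w, score j z (A i w, y i w) ∂μ =
      ∫ w, meanLogisticDeriv (inner ℝ (A i w) xs) (inner ℝ (A i w) z) * A i w j ∂μ := by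
  have hφ : ∀ v : ℝ, Measurable fun a : E d => logisticDeriv v (inner ℝ a z) * a j := fun v =>
    (HTSVRG.measurable_score j z).comp (f := fun a : E d => (a, v)) (by fun_prop)
  have hint : ∀ v : ℝ, v = 1 ∨ v = -1 →
      Integrable (fun w => logisticDeriv v (inner ℝ (A i w) z) * A i w j) μ := fun v hv => by
    refine Integrable.mono' ((h.integrable_entry i j).abs.const_mul 2)
      ((hφ v).comp (h.measurable_design i)).aestronglyMeasurable
      (Filter.Eventually.of_forall fun w => ?_)
    rw [norm_mul]
    refine mul_le_mul_of_nonneg_right ?_ (norm_nonneg _)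
    refine (abs_logisticDeriv_le _ _).trans ?_
    rcases hv with rfl | rfl <;> simp
  obtain ⟨a1, b1, c1⟩ := h.integral_mul_indicator i (Or.inl rfl) (hφ 1) (hint 1 (Or.inl rfl))
  obtain ⟨a2, b2, c2⟩ := h.integral_mul_indicator i (Or.inr rfl) (hφ (-1)) (hint (-1) (Or.inr rfl))
  have e1 : ∫ w, score j z (A i w, y i w) ∂μ = ∫ w, (logisticDeriv 1 (inner ℝ (A i w) z) * A i w j *
      Set.indicator {w | y i w = 1} (fun _ => (1 : ℝ)) w +
      logisticDeriv (-1) (inner ℝ (A i w) z) * A i w j *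
      Set.indicator {w | y i w = -1} (fun _ => (1 : ℝ)) w) ∂μ := by
    refine integral_congr_ae (Filter.Eventually.of_forall fun w => ?_)
    have hne : (-1 : ℝ) ≠ 1 := by norm_num
    rcases h.label_values i w with hy | hy
    · simp [score, Set.indicator, hy, hne.symm]
    · simp [score, Set.indicator, hy, hne]
  rw [e1, integral_add a1 a2, c1, c2, ← integral_add b1 b2]
  refine integral_congr_ae (Filter.Eventually.of_forall fun w => ?_)
  simp only [meanLogisticDeriv]
  ring

/-- The expected score vanishes at the true parameter. -/
lemma integral_score_self [IsProbabilityMeasure μ] (h : IsLogisticModel μ σ xs A y)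
    (i : Fin n) (j : Fin d) :
    ∫ w, score j xs (A i w, y i w) ∂μ = 0 := by
  rw [h.integral_score]
  simp [meanLogisticDeriv_self]

/-- The expected score vanishes off the supports of the true parameter and the evaluation point. -/
lemma integral_score_eq_zero_of_notMem [IsProbabilityMeasure μ] (h : IsLogisticModel μ σ xs A y)
    (i : Fin n) {j : Fin d}
    {z : E d} {S : Finset (Fin d)} (hxs : supp xs ⊆ S) (hz : supp z ⊆ S) (hj : j ∉ S) :
    ∫ w, score j z (A i w, y i w) ∂μ = 0 := by
  rw [h.integral_score]
  have hind : iIndepFun (fun (j : Fin d) (w : Ω) => A i w j) μ :=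
    h.indep_entries.precomp (g := fun j : Fin d => (i, j)) fun a b hab => (Prod.mk.inj hab).2
  have h1 := hind.indepFun_finset S {j} (by simpa using hj) (h.measurable_entry i)
  -- Both inner products involve only entries indexed by `S`, hence are independent of the centered
  -- entry `j`.
  have hsum : ∀ (x : E d), supp x ⊆ S → ∀ w,
      inner ℝ (A i w) x = ∑ l : S, A i w l * x l := fun x hx w => by
    rw [inner_eq_sum, Finset.sum_coe_sort S fun l => A i w l * x l]
    symm
    refine Finset.sum_subset (Finset.subset_univ S) fun l _ hl => ?_
    rw [supp_subset_iff.1 hx l hl, mul_zero]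
  have h2 : IndepFun (fun w => meanLogisticDeriv (inner ℝ (A i w) xs) (inner ℝ (A i w) z))
      (fun w => A i w j) μ := by
    have hm1 : Measurable fun a : S → ℝ =>
        meanLogisticDeriv (∑ l : S, a l * xs l) (∑ l : S, a l * z l) :=
      measurable_meanLogisticDeriv.comp
        (f := fun a : S → ℝ => (∑ l : S, a l * xs l, ∑ l : S, a l * z l)) (by fun_prop)
    have hm2 : Measurable fun a : ({j} : Finset (Fin d)) → ℝ => a ⟨j, by simp⟩ := by fun_prop
    have h3 := h1.comp hm1 hm2
    simp only [hsum xs hxs, hsum z hz]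
    exact h3
  rw [h2.integral_fun_mul_eq_mul_integral, h.mean_zero, mul_zero]
  · refine (measurable_meanLogisticDeriv.comp (f := fun w => ((inner ℝ (A i w) xs : ℝ),
      (inner ℝ (A i w) z : ℝ))) ?_).aestronglyMeasurable
    have := h.measurable_design i
    fun_prop
  · exact (h.measurable_entry i j).aestronglyMeasurable

/-! ### The population objective -/

lemma integrable_norm_design (h : IsLogisticModel μ σ xs A y) (i : Fin n) :
    Integrable (fun w => ‖A i w‖) μ := by
  refine Integrable.mono' (integrable_finsetSum Finset.univ fun j _ => (h.integrable_entry i j).abs)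
    (h.measurable_design i).norm.aestronglyMeasurable (Filter.Eventually.of_forall fun w => ?_)
  rw [norm_norm]
  refine le_of_sq_le_sq ?_ (Finset.sum_nonneg fun _ _ => abs_nonneg _)
  rw [norm_sq_eq_sum]
  calc ∑ j, A i w j ^ 2 = ∑ j, |A i w j| ^ 2 := by simp
    _ ≤ _ := Finset.sum_sq_le_sq_sum_of_nonneg fun _ _ => abs_nonneg _

lemma integrable_inner (h : IsLogisticModel μ σ xs A y) (i : Fin n) (x : E d) :
    Integrable (fun w => (inner ℝ (A i w) x : ℝ)) μ := by
  refine Integrable.mono' ((h.integrable_norm_design i).mul_const ‖x‖) ?_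
    (Filter.Eventually.of_forall fun w => norm_inner_le_norm _ _)
  have := h.measurable_design i
  exact Measurable.aestronglyMeasurable (by fun_prop)

lemma measurable_loss (h : IsLogisticModel μ σ xs A y) (i : Fin n) {g : Ω → ℝ}
    (hg : Measurable g) : Measurable fun w => Real.log (1 + Real.exp (-2 * y i w * g w)) := by
  have := h.measurable_label i
  fun_prop

lemma integrable_loss [IsProbabilityMeasure μ] (h : IsLogisticModel μ σ xs A y)
    (i : Fin n) {g : Ω → ℝ}
    (hg : Measurable g) (hgint : Integrable g μ) :
    Integrable (fun w => Real.log (1 + Real.exp (-2 * y i w * g w))) μ := by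
  refine Integrable.mono' ((hgint.abs.const_mul 2).add (integrable_const (Real.log 2)))
    (h.measurable_loss i hg).aestronglyMeasurable (Filter.Eventually.of_forall fun w => ?_)
  have h1 := abs_logistic_sub_le (y i w) (g w) 0
  rw [h.abs_label] at h1
  have h2 : Real.log (1 + Real.exp (-2 * y i w * 0)) = Real.log 2 := by norm_num
  have h3 := Real.log_nonneg (show (1 : ℝ) ≤ 2 by norm_num)
  rw [h2] at h1
  simp only [mul_one, sub_zero] at h1
  rw [Real.norm_eq_abs]
  have := abs_sub_abs_le_abs_sub (Real.log (1 + Real.exp (-2 * y i w * g w))) (Real.log 2)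
  rw [abs_of_nonneg h3] at this
  simp only [Pi.add_apply]
  linarith

lemma measurable_inner (h : IsLogisticModel μ σ xs A y) (i : Fin n) (x : E d) :
    Measurable fun w => (inner ℝ (A i w) x : ℝ) := by
  have := h.measurable_design i
  fun_prop

/-- The expected unregularized loss of a sample. -/
def risk (μ : Measure Ω) (A : Fin n → Ω → E d) (y : Fin n → Ω → ℝ) (i : Fin n) (x : E d) : ℝ :=
  ∫ w, Real.log (1 + Real.exp (-2 * y i w * inner ℝ (A i w) x)) ∂μ

lemma continuous_risk [IsProbabilityMeasure μ] (h : IsLogisticModel μ σ xs A y) (i : Fin n) :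
    Continuous (risk μ A y i) := by
  set c : NNReal := ⟨∫ w, 2 * ‖A i w‖ ∂μ, integral_nonneg fun w => by positivity⟩ with hc
  refine (LipschitzWith.of_dist_le_mul (K := c) fun x x' => ?_).continuous
  have hi := fun x => h.integrable_loss i (h.measurable_inner i x) (h.integrable_inner i x)
  rw [dist_eq_norm, dist_eq_norm, risk, risk, ← integral_sub (hi x) (hi x')]
  refine (norm_integral_le_integral_norm _).trans ?_
  change _ ≤ (∫ w, 2 * ‖A i w‖ ∂μ) * ‖x - x'‖
  rw [← integral_mul_const]
  refine integral_mono ((hi x).sub (hi x')).norm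
    (((h.integrable_norm_design i).const_mul 2).mul_const _) fun w => ?_
  refine (abs_logistic_sub_le _ _ _).trans ?_
  rw [h.abs_label, ← inner_sub_right, mul_one, mul_assoc]
  gcongr
  exact abs_real_inner_le_norm _ _

/-- Integrate the tangent inequality of the loss at `xs`; the linear term has mean zero. This is
what forces the regularized minimizer to have norm at most `‖xs‖`. -/
lemma risk_self_le [IsProbabilityMeasure μ] (h : IsLogisticModel μ σ xs A y)
    (i : Fin n) (x : E d) :
    risk μ A y i xs ≤ risk μ A y i x := by
  have hi := fun x => h.integrable_loss i (h.measurable_inner i x) (h.integrable_inner i x)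
  have hs : Integrable (fun w => ∑ j, (x - xs) j * score j xs (A i w, y i w)) μ :=
    integrable_finsetSum _ fun j _ => (h.integrable_score i j xs).const_mul _
  have hs0 : ∫ w, ∑ j, (x - xs) j * score j xs (A i w, y i w) ∂μ = 0 := by
    rw [integral_finsetSum _ fun j _ => (h.integrable_score i j xs).const_mul _]
    refine Finset.sum_eq_zero fun j _ => ?_
    rw [integral_const_mul, h.integral_score_self, mul_zero]
  have h1 : ∫ w, (Real.log (1 + Real.exp (-2 * y i w * inner ℝ (A i w) xs)) +
      ∑ j, (x - xs) j * score j xs (A i w, y i w)) ∂μ ≤ risk μ A y i x := by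
    refine integral_mono ((hi xs).add hs) (hi x) fun w => ?_
    have h2 := logistic_add_logisticDeriv_mul_le (y i w) (inner ℝ (A i w) xs) (inner ℝ (A i w) x)
    rw [← inner_sub_right, inner_eq_sum _ (x - xs), Finset.mul_sum] at h2
    refine le_trans (le_of_eq ?_) h2
    simp only [score]
    congr 1
    exact Finset.sum_congr rfl fun j _ => by ring
  rw [integral_add (hi xs) hs, hs0, add_zero] at h1
  exact h1

lemma hasDerivAt_risk [IsProbabilityMeasure μ] (h : IsLogisticModel μ σ xs A y)
    (i : Fin n) (z : E d) (j : Fin d) :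
    HasDerivAt (fun t : ℝ => risk μ A y i (z + t • EuclideanSpace.single j 1))
      (∫ w, score j z (A i w, y i w) ∂μ) 0 := by
  have hin : ∀ (t : ℝ) (w : Ω), inner ℝ (A i w) (z + t • EuclideanSpace.single j (1 : ℝ)) =
      inner ℝ (A i w) z + t * A i w j := fun t w => by
    rw [inner_add_right, inner_smul_right, EuclideanSpace.inner_single_right]
    simp
  have hm := h.measurable_inner i z
  have hb := h.measurable_entry i j
  have key := hasDerivAt_integral_of_dominated_loc_of_deriv_le (μ := μ) (s := Set.univ)
    (F := fun t w => Real.log (1 + Real.exp (-2 * y i w * (inner ℝ (A i w) z + t * A i w j))))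
    (F' := fun t w => logisticDeriv (y i w) (inner ℝ (A i w) z + t * A i w j) * A i w j)
    (bound := fun w => 2 * |A i w j|) (x₀ := (0 : ℝ)) Filter.univ_mem
    (Filter.Eventually.of_forall fun t =>
      (h.measurable_loss i (hm.add (hb.const_mul t))).aestronglyMeasurable)
    (h.integrable_loss i (hm.add (hb.const_mul 0))
      ((h.integrable_inner i z).add ((h.integrable_entry i j).const_mul 0)))
    (by simpa [score] using (h.measurable_score i j z).aestronglyMeasurable)
    (Filter.Eventually.of_forall fun w t _ => by
      rw [norm_mul]
      refine mul_le_mul_of_nonneg_right ?_ (norm_nonneg _)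
      simpa [h.abs_label] using abs_logisticDeriv_le (y i w) (inner ℝ (A i w) z + t * A i w j))
    ((h.integrable_entry i j).abs.const_mul 2)
    (Filter.Eventually.of_forall fun w t _ => by
      have h1 : HasDerivAt (fun t : ℝ => inner ℝ (A i w) z + t * A i w j) (A i w j) t := by
        simpa using ((hasDerivAt_id t).mul_const (A i w j)).const_add (inner ℝ (A i w) z)
      exact (hasDerivAt_logistic (y i w) _).comp t h1)
  have hd := key.2
  simp only [zero_mul, add_zero] at hd
  simp only [risk, hin]
  exact hd

/-- There is a sparse reference point, depending on the model only, at which the expected gradient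
of the regularized objective vanishes. -/
theorem exists_reference_point [IsProbabilityMeasure μ] (h : IsLogisticModel μ σ xs A y)
    (hn : 0 < n) {γ : ℝ}
    (hγ : 0 ≤ γ) : ∃ z : E d, supp z ⊆ supp xs ∧ ‖z‖ ≤ ‖xs‖ ∧
      ∀ j, ∑ i, ∫ w, score j z (A i w, y i w) ∂μ + n * γ * z j = 0 := by
  rcases hγ.eq_or_lt with rfl | hγ
  · exact ⟨xs, subset_rfl, le_rfl, fun j => by simp [h.integral_score_self]⟩
  have hnγ : 0 < n * γ := by positivity
  set P : E d → ℝ := fun x => ∑ i, risk μ A y i x + n * γ / 2 * ‖x‖ ^ 2 with hP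
  have hPc : Continuous P := by
    have := h.continuous_risk
    fun_prop
  -- The margin `1` in the radius keeps the minimizer, of norm at most `‖xs‖`, off the boundary of
  -- the ball, so no multiplier enters stationarity.
  set V : Set (E d) := Metric.closedBall 0 (‖xs‖ + 1) ∩ {x | ∀ j, j ∉ supp xs → x j = 0} with hV
  have hVc : IsCompact V := by
    refine (isCompact_closedBall _ _).inter_right ?_
    simp only [Set.ofPred_forall]
    exact isClosed_iInter fun j => isClosed_iInter fun _ =>
      isClosed_eq (by fun_prop) continuous_const
  have hxsV : xs ∈ V := ⟨by simp, fun j hj => eq_zero_of_notMem_supp hj⟩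
  obtain ⟨z, hzV, hmin⟩ := hVc.exists_isMinOn ⟨xs, hxsV⟩ hPc.continuousOn
  have hzS : supp z ⊆ supp xs := supp_subset_iff.2 hzV.2
  have hznorm : ‖z‖ ≤ ‖xs‖ := by
    have h1 : P z ≤ P xs := hmin hxsV
    have h2 : ∑ i, risk μ A y i xs ≤ ∑ i, risk μ A y i z :=
      Finset.sum_le_sum fun i _ => h.risk_self_le i z
    simp only [hP] at h1
    refine le_of_sq_le_sq ?_ (norm_nonneg _)
    refine le_of_mul_le_mul_left ?_ (half_pos hnγ)
    linarith
  refine ⟨z, hzS, hznorm, fun j => ?_⟩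
  -- On the support the coordinate line stays in `V` near `z`, so the derivative vanishes; off it `z
  -- j = 0` and independence kills the mean score.
  by_cases hj : j ∈ supp xs
  · have hnormd : HasDerivAt (fun t : ℝ => ‖z + t • EuclideanSpace.single j (1 : ℝ)‖ ^ 2)
        (2 * z j) 0 := by
      have h1 : HasDerivAt (fun t : ℝ => z + t • EuclideanSpace.single j (1 : ℝ))
          (EuclideanSpace.single j 1) 0 := by
        simpa using ((hasDerivAt_id (0 : ℝ)).smul_const
          (EuclideanSpace.single j (1 : ℝ))).const_add z
      have h2 := h1.norm_sq
      simpa [EuclideanSpace.inner_single_right] using h2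
    have hd : HasDerivAt (fun t : ℝ => P (z + t • EuclideanSpace.single j 1))
        (∑ i, ∫ w, score j z (A i w, y i w) ∂μ + n * γ / 2 * (2 * z j)) 0 :=
      (HasDerivAt.fun_sum fun i _ => h.hasDerivAt_risk i z j).add (hnormd.const_mul _)
    have hloc : IsLocalMin (fun t : ℝ => P (z + t • EuclideanSpace.single j 1)) 0 := by
      have hcont : ContinuousAt (fun t : ℝ => ‖z + t • EuclideanSpace.single j (1 : ℝ)‖) 0 := by
        fun_prop
      have hlt : ‖z + (0 : ℝ) • EuclideanSpace.single j (1 : ℝ)‖ < ‖xs‖ + 1 := by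
        simp only [zero_smul, add_zero]
        linarith
      filter_upwards [hcont.eventually (gt_mem_nhds hlt)] with t ht
      have : z + t • EuclideanSpace.single j 1 ∈ V := by
        refine ⟨by simpa using ht.le, fun l hl => ?_⟩
        have hlj : l ≠ j := fun hlj => hl (hlj ▸ hj)
        simp [hzV.2 l hl, hlj]
      simpa using hmin this
    have := hloc.hasDerivAt_eq_zero hd
    linarith
  · rw [hzV.2 j hj, mul_zero, add_zero]
    exact Finset.sum_eq_zero fun i _ => h.integral_score_eq_zero_of_notMem i subset_rfl hzS hj

end IsLogisticModel

end HTSVRG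

end

/-! ### Concentration of the empirical gradient at the reference point. -/

noncomputable section

namespace HTSVRG

/-! ### The gradient at the reference point -/

namespace IsLogisticModel

variable {n d : ℕ} {Ω : Type*} [MeasurableSpace Ω] {μ : Measure Ω} {σ : ℝ} {xs : E d}
  {A : Fin n → Ω → E d} {y : Fin n → Ω → ℝ}

/-- With high probability every coordinate of the score is close to its expectation. -/
lemma exists_score_event [IsProbabilityMeasure μ] (h : IsLogisticModel μ σ xs A y) (hn : 0 < n)
    (hd : 0 < d) (hσ : 0 < σ) (z : E d) :
    ∃ S : Set Ω, MeasurableSet S ∧ 1 - 4 / (d : ℝ) ≤ μ.real S ∧ ∀ w ∈ S, ∀ j,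
      |∑ i, (score j z (A i w, y i w) - ∫ w, score j z (A i w, y i w) ∂μ)| <
        8 * σ * √(n * Real.log d) := by
  have hlog : 0 ≤ Real.log d := Real.log_natCast_nonneg d
  have hd' : (0 : ℝ) < d := by exact_mod_cast hd
  have hn' : (0 : ℝ) < n := by exact_mod_cast hn
  -- The factor `8` makes the tail exponent `64 / 32 * log d`, so each coordinate fails with
  -- probability at most `2 / d²` and the union bound costs `2 / d`.
  set ε := 8 * σ * √(n * Real.log d) with hε
  have hε2 : ε ^ 2 / (32 * n * σ ^ 2) = 2 * Real.log d := by
    rw [hε, mul_pow, Real.sq_sqrt (by positivity)]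
    field_simp
    ring
  set T : Fin d → Set Ω := fun j =>
    {w | ε ≤ |∑ i, (score j z (A i w, y i w) - ∫ w, score j z (A i w, y i w) ∂μ)|} with hT
  have hTm : ∀ j, MeasurableSet (T j) := fun j => by
    refine measurableSet_le measurable_const ?_
    have := fun i => h.measurable_score i j z
    fun_prop
  have hTle : ∀ j, μ.real (T j) ≤ 2 / d ^ 2 := fun j => by
    have hind : iIndepFun (fun i w => score j z (A i w, y i w)) μ :=
      h.indep_samples.comp (fun _ => score j z) fun _ => HTSVRG.measurable_score j z
    refine (measureReal_abs_sum_ge_le (fun i => h.subGaussian i j)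
      (fun i => h.measurable_score i j z) (fun i => h.abs_score_le i j z) hind
      (by positivity : 0 ≤ ε)).trans (le_of_eq ?_)
    rw [hε2, Real.exp_neg, two_mul (Real.log d), Real.exp_add, Real.exp_log hd']
    field_simp
  have hU : μ.real (⋃ j, T j) ≤ 4 / d := by
    refine (measureReal_iUnion_fintype_le T).trans ?_
    calc ∑ j, μ.real (T j) ≤ ∑ _j : Fin d, 2 / (d : ℝ) ^ 2 := Finset.sum_le_sum fun j _ => hTle j
      _ = 2 / d := by simp; field_simp
      _ ≤ 4 / d := by gcongr; norm_num
  have hUm : MeasurableSet (⋃ j, T j) := MeasurableSet.iUnion hTm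
  refine ⟨(⋃ j, T j)ᶜ, hUm.compl, ?_, fun w hw j => ?_⟩
  · rw [probReal_compl_eq_one_sub hUm]
    linarith
  · by_contra hlt
    exact hw (Set.mem_iUnion.2 ⟨j, not_lt.1 hlt⟩)

end IsLogisticModel

lemma gradient_average_logisticLoss_apply {n d : ℕ} (γ : ℝ) (a : Fin n → E d) (v : Fin n → ℝ)
    (hn : 0 < n) (z : E d) (j : Fin d) :
    gradient (average fun i => logisticLoss γ (a i) (v i)) z j =
      (n : ℝ)⁻¹ * (∑ i, score j z (a i, v i) + n * γ * z j) := by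
  have hn' : (n : ℝ) ≠ 0 := by positivity
  rw [gradient_average fun i => differentiable_logisticLoss γ (a i) (v i)]
  simp only [gradient_logisticLoss, PiLp.smul_apply, WithLp.ofLp_sum, Finset.sum_apply,
    PiLp.add_apply, smul_eq_mul, Finset.sum_add_distrib, score]
  simp [mul_assoc]

lemma norm_coordProj_le_of_abs_le {d : ℕ} {g : E d} {b : ℝ} (hg : ∀ j, |g j| ≤ b)
    (I : Finset (Fin d)) : ‖coordProj I g‖ ≤ √I.card * b := by
  rcases I.eq_empty_or_nonempty with rfl | ⟨j, -⟩
  · have : coordProj ∅ g = 0 := by ext j; simp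
    simp [this]
  have hb : 0 ≤ b := (abs_nonneg _).trans (hg j)
  refine le_of_sq_le_sq ?_ (by positivity)
  rw [norm_sq_eq_sum, mul_pow, Real.sq_sqrt (Nat.cast_nonneg _)]
  calc ∑ j, coordProj I g j ^ 2 = ∑ j ∈ I, g j ^ 2 := by
        simp [coordProj_apply, ite_pow, Finset.sum_ite_mem]
    _ ≤ ∑ _j ∈ I, b ^ 2 := Finset.sum_le_sum fun j _ => by
        rw [← sq_abs]
        exact pow_le_pow_left₀ (abs_nonneg _) (hg j) 2
    _ = _ := by simp

end HTSVRG

end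

/-! ### Choice of constants and assembly. -/

open HTSVRG in
theorem proposition10 :
    ∃ C₀ η₀ M β : ℝ, 0 < C₀ ∧ 0 < η₀ ∧ η₀ < 1 / 4 ∧ 0 < M ∧ 0 < β ∧ β < 1 ∧
    ∀ ω C₁ : ℝ, 0 < ω → 0 < C₁ → ∃ C : ℝ, 0 < C ∧
    ∀ (n d k K : ℕ) (σ γ : ℝ), 1 ≤ K → K ≤ k → k ≤ d → 0 < σ → 0 ≤ γ →
      C₀ * ((3 * (k : ℝ) + K) * Real.log d) ≤ n →
      γ ≤ C₁ * HTSVRG.rate n d k K →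
    ∀ (Ω : Type*) [MeasurableSpace Ω] (μ : Measure Ω) [IsProbabilityMeasure μ]
      (xs : HTSVRG.E d) (A : Fin n → Ω → HTSVRG.E d) (y : Fin n → Ω → ℝ),
      HTSVRG.zeroNorm xs ≤ K → ‖xs‖ ≤ ω → HTSVRG.IsLogisticModel μ σ xs A y →
    ∃ G : Set Ω, MeasurableSet G ∧ 1 - 4 / (d : ℝ) ≤ μ.real G ∧
    ∀ w ∈ G, ∀ f : Fin n → HTSVRG.E d → ℝ,
      (f = fun i => HTSVRG.logisticLoss γ (A i w) (y i w)) →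
    ∀ α L : ℝ,
      HTSVRG.RSC (k + K) α (HTSVRG.average f) →
      (∀ i, HTSVRG.RSS (3 * k + K) L (f i)) →
    ∀ (η : ℝ) (m : ℕ), 0 < η → η ≤ η₀ / L →
      HTSVRG.nuFactor d k K ≤ 1 / (1 - η * α) →
      M / (η * α) ≤ m →
    ∀ H : HTSVRG.E d → HTSVRG.E d, HTSVRG.IsHardThresholding k H →
    ∀ x0 : HTSVRG.E d, HTSVRG.zeroNorm x0 ≤ k → ‖x0‖ ≤ ω →
    ∀ (q : ℕ) (xh : HTSVRG.E d), q = K ∨ q = k →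
      HTSVRG.IsSparseOptimum q ω (HTSVRG.average f) xh →
    ∃ τ : ℝ, 0 ≤ τ ∧ τ ≤ C * (σ * HTSVRG.rate n d k K) ∧
    ∀ s : ℕ,
      HTSVRG.expectedValue f H ω η m x0 s (HTSVRG.average f) - HTSVRG.average f xh ≤
        β ^ s * (HTSVRG.average f x0 - HTSVRG.average f xh) + τ := by
  -- Here `96 = 12 * 8`: the factor of `ωG` in the deterministic bound times the one in `G = 8σ ·
  -- rate`.
  refine ⟨1, 1 / 40, 20, 1 / 2, by norm_num, by norm_num, by norm_num, by norm_num, by norm_num,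
    by norm_num, fun ω C₁ hω _ => ⟨96 * ω, by positivity, ?_⟩⟩
  intro n d k K σ γ hK hKk hkd hσ hγ hnd _ Ω _ μ _ xs A y hxs hxsω hmodel
  -- For `d = 1` the required probability `1 - 4 / d` is negative and the empty event suffices; `log
  -- d > 0` is needed to get `n > 0`.
  rcases Nat.lt_or_ge d 2 with hd | hd
  · obtain rfl : d = 1 := by omega
    exact ⟨∅, MeasurableSet.empty, by norm_num, fun w hw => hw.elim⟩
  have hlog : 0 < Real.log d := Real.log_pos (by exact_mod_cast hd)
  have hk : (0 : ℝ) < k := by exact_mod_cast (by omega : 0 < k)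
  have hn' : (0 : ℝ) < n := lt_of_lt_of_le (by positivity) hnd
  have hn : 0 < n := by exact_mod_cast hn'
  obtain ⟨z, hzS, hzn, hz0⟩ := hmodel.exists_reference_point hn hγ
  obtain ⟨S, hSm, hSp, hS⟩ := hmodel.exists_score_event hn (by omega) hσ z
  refine ⟨S, hSm, hSp, ?_⟩
  rintro w hw f rfl α L hrsc hrss η m hη hηL hν hm H hH x0 hx0 hx0ω q xh hq hxh
  have hrate : 0 ≤ rate n d k K := Real.sqrt_nonneg _
  have hcoord : ∀ j, |gradient (average fun i => logisticLoss γ (A i w) (y i w)) z j| ≤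
      8 * σ * √(Real.log d / n) := fun j => by
    have h1 := (hS w hw j).le
    rw [Finset.sum_sub_distrib] at h1
    -- Stationarity of `z` trades the regularization term for minus the mean score, leaving a purely
    -- centered sum.
    have h2 : ∑ i, score j z (A i w, y i w) + n * γ * z j = ∑ i, score j z (A i w, y i w) -
        ∑ i, ∫ w, score j z (A i w, y i w) ∂μ := by linarith [hz0 j]
    rw [gradient_average_logisticLoss_apply γ (fun i => A i w) (fun i => y i w) hn, h2, abs_mul,
      abs_inv, abs_of_pos hn', inv_mul_le_iff₀ hn']
    refine h1.trans (le_of_eq ?_)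
    have h3 : (n : ℝ) * Real.log d = n ^ 2 * (Real.log d / n) := by field_simp
    rw [h3, Real.sqrt_mul (sq_nonneg _), Real.sqrt_sq hn'.le]
    ring
  have hgrad : ∀ I : Finset (Fin d), I.card ≤ 3 * k + K →
      ‖coordProj I (gradient (average fun i => logisticLoss γ (A i w) (y i w)) z)‖ ≤
        8 * σ * rate n d k K := fun I hI => by
    refine (norm_coordProj_le_of_abs_le hcoord I).trans ?_
    have h1 : (I.card : ℝ) ≤ 3 * k + K := by exact_mod_cast hI
    calc √(I.card : ℝ) * (8 * σ * √(Real.log d / n))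
        ≤ √(3 * (k : ℝ) + K) * (8 * σ * √(Real.log d / n)) := by gcongr
      _ = 8 * σ * (√(3 * (k : ℝ) + K) * √(Real.log d / n)) := by ring
      _ = 8 * σ * rate n d k K := by
        rw [← Real.sqrt_mul (by positivity), rate, mul_div_assoc]
  refine ⟨12 * ω * (8 * σ * rate n d k K), by positivity, le_of_eq (by ring), fun s => ?_⟩
  exact expectedValue_sub_le hn hK hKk hkd hω hη hηL
    (fun i => firstOrderConvex_logisticLoss hγ (A i w) (y i w)) hrsc hrss hν hm
    ((zeroNorm_le_card hzS).trans (card_supp xs ▸ hxs)) (hzn.trans hxsω) (by positivity) hgrad hH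
    ⟨hx0, hx0ω⟩ hq hxh s
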